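/- **Setting.** Let $S_1,\dots,S_n\subset\mathbb{R}^2$ be $C^1$ embedded circles, pairwise disjoint except for one common point $b$ at which they touch (they are tangent at $b$), oriented so that their orientations agree at $b$; for example, nested circles touching at $b$, all oriented anticlockwise. Let $G_n=\bigcup_i S_i$, a bouquet of $n$ circles with branching point $b$. Choose regular $C^1$ parametrizations $\gamma_i$ of $S_i$ by $[0,1]$ in the positive direction, with $\gamma_i(0)=\gamma_i(1)=b$. The derivative of a map $g:G_n\to G_n$ at a point $x\neq b$ is taken with respect to these parametrizations around $x$ and $g(x)$ (if $g(x)=b$, only its sign matters, and it does not depend on which circle through $b$ is used). It is the derivative of the lift of $g$ to a map $[0,n]\to[0,n]$. Let $\mathcal{M}^n_b$ be the class of continuous maps $f:G_n\to G_n$ such that 1. $f$ is $C^1$ on $G_n\setminus\{b\}$ (as a map into the plane); 2. $|Df^m(x)|>1$ for every $m\ge 1$ and every $x\ne b$ with $f^m(x)=x$; 3. the sign of the derivative of (the lift of) $f$ is constant on $G_n\setminus\{b\}$; 4. $f^m(b)\neq b$ for all $m\ge1$. A map $g:G_n\to G_n$ is *orientation preserving* (resp. *reversing*) if the derivative of its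 lift exists and is positive (resp. negative) at all but finitely many points. For continuous $g:G_n\to G_n$ let $L(g)=\operatorname{Tr}(g_{*0})-\operatorname{Tr}(g_{*1})$, where $g_{*k}$ is the induced endomorphism of the singular homology $H_k(G_n;\mathbb{Q})$, and let $$l(f^m)=\sum_{r\mid m}\mu(r)\,L\bigl(f^{m/r}\bigr),$$ where $\mu$ is the Möbius function. Let $\mathrm{Fix}(f^m)$ be the set of fixed points of $f^m$, and $\mathrm{Per}_m(f)$ the set of periodic points of $f$ of least period $m$. **Theorem.** Let $f\in\mathcal{M}^n_b$. In each of the following cases the set that is counted is finite, and: (a) for all $m\ge1$, if $f^m$ is orientation preserving, then $L(f^m)=-\#\mathrm{Fix}(f^m)$; (b) for all $m\ge1$, if $f^m$ is orientation reversing, then $L(f^m)=\#\mathrm{Fix}(f^m)$; (c) if $f$ is orientation preserving, then $|l(f^m)|=\#\mathrm{Per}_m(f)$ for all $m\ge1$; (d) if $f$ is orientation reversing, then $|l(f^m)|=\#\mathrm{Per}_m(f)$ for every $m\ge1$ that is odd or divisible by $4$. -/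

import Mathlib

/-- The map induced by `f : X → X` on the singular homology group `H_k(X; ℚ)`. -/
noncomputable def homologyMap {X : Type} [TopologicalSpace X] (f : C(X, X)) (k : ℕ) :
    (((AlgebraicTopology.singularHomologyFunctor (ModuleCat.{0} ℚ) k).obj
      (ModuleCat.of ℚ ℚ)).obj (TopCat.of X)) →ₗ[ℚ]
    (((AlgebraicTopology.singularHomologyFunctor (ModuleCat.{0} ℚ) k).obj
      (ModuleCat.of ℚ ℚ)).obj (TopCat.of X)) :=
  (((AlgebraicTopology.singularHomologyFunctor (ModuleCat.{0} ℚ) k).obj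
    (ModuleCat.of ℚ ℚ)).map (TopCat.ofHom f)).hom

/-- The Lefschetz number `∑_{k=0}^{dim} (-1)^k Tr(f_{*k})` of a self-map of a space `X` of
dimension `dim`. -/
noncomputable def lefschetzNumber {X : Type} [TopologicalSpace X] (dim : ℕ) (f : C(X, X)) : ℚ :=
  ∑ k ∈ Finset.range (dim + 1), (-1) ^ k * LinearMap.trace ℚ _ (homologyMap f k)

/-- The `m`-th iterate of a continuous self-map. -/
def iter {X : Type} [TopologicalSpace X] (f : C(X, X)) (m : ℕ) : C(X, X) :=
  ⟨f^[m], f.continuous.iterate m⟩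

/-- The Lefschetz number of period `m`: `l(f^m) = ∑_{r ∣ m} μ(r) L(f^{m/r})`. -/
noncomputable def periodicLefschetzNumber {X : Type} [TopologicalSpace X] (dim : ℕ)
    (f : C(X, X)) (m : ℕ) : ℚ :=
  ∑ r ∈ m.divisors, (ArithmeticFunction.moebius r : ℚ) * lefschetzNumber dim (iter f (m / r))

/-- A bouquet of `n` circles in the plane: oriented `C^1` circles `S_i`, each the image of a regular
`1`-periodic parametrization `arc i` starting at the branching point `b`, pairwise disjoint
except at `b`, where they touch, i.e. are tangent, their orientations there agreeing.
(Nested circles that touch at `b`, all with the anticlockwise orientation, are of this kind.) -/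
structure Bouquet (n : ℕ) where
  /-- the branching point -/
  b : ℂ
  /-- `arc i` goes once around `S_i` on `[0,1]`, in the positive direction -/
  arc : Fin n → ℝ → ℂ
  contDiff_arc : ∀ i, ContDiff ℝ 1 (arc i)
  deriv_arc_ne_zero : ∀ i t, deriv (arc i) t ≠ 0
  periodic_arc : ∀ i, Function.Periodic (arc i) 1
  injOn_arc : ∀ i, Set.InjOn (arc i) (Set.Ico 0 1)
  arc_zero : ∀ i, arc i 0 = b
  eq_b_of_mem_of_mem : ∀ i j s t, i ≠ j → arc i s = arc j t → arc i s = b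
  tangent_at_b : ∀ i j, ∃ c : ℝ, 0 < c ∧ deriv (arc i) 0 = c • deriv (arc j) 0

namespace Bouquet

variable {n : ℕ} (G : Bouquet n)

/-- The underlying subset `G_n = ⋃ S_i` of the plane. -/
def carrier : Set ℂ := {G.b} ∪ ⋃ i, Set.range (G.arc i)

/-- The space `G_n`, with the subspace topology. -/
abbrev Space : Type := G.carrier

/-- The branching point, as a point of `G_n`. -/
def base : G.Space := ⟨G.b, Or.inl rfl⟩

/-- The point of `S_i` with parameter `t`. For `t ∈ (0,1)` these are the points of `G_n \ {b}`. -/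
def pt (i : Fin n) (t : ℝ) : G.Space :=
  ⟨G.arc i t, Or.inr (Set.mem_iUnion.2 ⟨i, t, rfl⟩)⟩

/-- `g` is differentiable at the point `G.pt i t`, and its derivative with respect to the
positively oriented parametrizations around `G.pt i t` and around its image `G.pt j s` is `d`.
In other words, `d` is the derivative at `i + t` of the lift of `g` to an interval. If the image is
`b`, then different choices of `j` may scale `d` by a positive factor. -/
def HasLiftDeriv (g : G.Space → G.Space) (i : Fin n) (t d : ℝ) : Prop :=
  ∃ j s, g (G.pt i t) = G.pt j s ∧
    HasDerivAt (fun u => (g (G.pt i u) : ℂ)) (d • deriv (G.arc j) s) t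

/-- `g` preserves orientation: its lift has positive derivative off a finite set. (An iterate of a
map that is `C^1` off `b` need not be differentiable at the points whose orbit meets `b`.) -/
def OrientationPreserving (g : G.Space → G.Space) : Prop :=
  ∀ i, {t ∈ Set.Ioo (0 : ℝ) 1 | ¬ ∃ d, 0 < d ∧ G.HasLiftDeriv g i t d}.Finite

/-- `g` reverses orientation: its lift has negative derivative off a finite set. -/
def OrientationReversing (g : G.Space → G.Space) : Prop :=
  ∀ i, {t ∈ Set.Ioo (0 : ℝ) 1 | ¬ ∃ d, d < 0 ∧ G.HasLiftDeriv g i t d}.Finite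

/-- The class `𝓜ⁿ` of continuous self-maps of `G_n`. -/
structure MemM (f : C(G.Space, G.Space)) : Prop where
  /-- `f` is `C^1` on `G_n \ {b}` -/
  contDiffOn : ∀ i, ContDiffOn ℝ 1 (fun t => (f (G.pt i t) : ℂ)) (Set.Ioo 0 1)
  /-- every fixed point `x ≠ b` of an iterate `f^m` satisfies `|Df^m(x)| > 1` -/
  repelling : ∀ m : ℕ, 1 ≤ m → ∀ i, ∀ t ∈ Set.Ioo (0 : ℝ) 1,
    Function.IsFixedPt f^[m] (G.pt i t) →
      ∃ d : ℝ, HasDerivAt (fun u => (f^[m] (G.pt i u) : ℂ)) (d • deriv (G.arc i) t) t ∧ 1 < |d|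
  /-- the derivative of the lift has constant sign -/
  sign_const : ∃ σ : SignType, ∀ i, ∀ t ∈ Set.Ioo (0 : ℝ) 1,
    ∃ d, G.HasLiftDeriv f i t d ∧ SignType.sign d = σ

/-- The class `𝓜ⁿ_b`: maps in `𝓜ⁿ` for which `b` is not periodic. -/
structure MemMb (f : C(G.Space, G.Space)) : Prop extends G.MemM f where
  b_not_periodic : ∀ m : ℕ, 1 ≤ m → f^[m] G.base ≠ G.base

end Bouquet

/-- The set of periodic points of `f` of (least) period `m`. -/
def periodicPoints {X : Type} (f : X → X) (m : ℕ) : Set X :=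
  {x | x ∈ Function.periodicPts f ∧ Function.minimalPeriod f x = m}

/-! Write `r i` for the retraction of the bouquet onto its circle `S_i`, which collapses the other
circles, and `D_i` for the degree of `r i ∘ g` on `S_i`. The loops form a basis of first homology,
and the windings of the `r i` are its coordinates, so `L(g) = 1 - ∑ D_i`
(`Bouquet.lefschetzNumber_eq`). That the loops span is shown directly on chains: modulo loops, the
class of a path is a difference of a potential at its ends, by local contraction and subdivision
(`Bouquet.mkQ_pathClass`). Hence a cycle is a combination of loops.

Let `g b ≠ b`, and let `θ` lift `r i ∘ g` on `S_i`. Fixed points on `S_i` are the `t ∈ (0,1)` with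
`θ t - t` an integer. If `ε (d - 1) > 0` for the derivative `d` at each of them, then `ε (θ t - t)`
crosses every integer upwards, so the crossings are counted by the floors of its end values. The
count is `ε (D_i - 1)` on the one circle that contains `g b`, and `ε D_i` on the others, where `θ`
is constant near the ends. In total `#Fix = ε (∑ D_i - 1) = -ε L(g)`
(`Bouquet.lefschetzNumber_eq_ncard`).

For `g = f^m`, a fixed point has an orbit that avoids `b`, since `b` is not periodic. By the chain
rule the derivative there has sign `σ ^ m`, where `σ` is the sign for `f`; as its modulus exceeds 1,
`ε = σ ^ m` serves. This gives (a) and (b). Parts (c) and (d) follow by Möbius inversion once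
`L(f^{m/r}) = c · #Fix(f^{m/r})` with one sign `c` for all squarefree `r ∣ m`. If `σ = -1`, this
sign depends on the parity of `m / r`, which is constant when `m` is odd or divisible by 4. -/

section

open CategoryTheory AlgebraicTopology Simplicial HomologicalComplex

/-! ### Singular 1-chains modulo boundaries, and classes of paths -/

namespace SingularOne

variable {X Y : Type} [TopologicalSpace X] [TopologicalSpace Y]

/-- The singular simplicial set of `X`. -/
noncomputable abbrev singularSet (X : Type) [TopologicalSpace X] : SSet.{0} :=
  TopCat.toSSet.obj (TopCat.of X)

/-- The rational singular chain complex of `X`. -/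
noncomputable abbrev chains (X : Type) [TopologicalSpace X] : ChainComplex (ModuleCat.{0} ℚ) ℕ :=
  (singularSet X).chainComplex (ModuleCat.of ℚ ℚ)

/-- The map of singular simplicial sets induced by a continuous map. -/
noncomputable abbrev singularMap (f : C(X, Y)) : singularSet X ⟶ singularSet Y :=
  TopCat.toSSet.map (TopCat.ofHom f)

/-- The singular `k`-chain given by a single simplex. -/
noncomputable def simplexChain {k : ℕ} (σ : (singularSet X) _⦋k⦌) : (chains X).X k :=
  ((singularSet X).ιChainComplex (R := ModuleCat.of ℚ ℚ) σ).hom (1 : ℚ)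

theorem chain_hom_ext {k : ℕ} {M : Type} [AddCommGroup M] [Module ℚ M]
    {u v : (chains X).X k →ₗ[ℚ] M} (h : ∀ σ, u (simplexChain σ) = v (simplexChain σ)) : u = v := by
  have : ModuleCat.ofHom u = ModuleCat.ofHom v := by
    refine SSet.chainComplex_hom_ext fun σ => ModuleCat.hom_ext (LinearMap.ext_ring ?_)
    exact h σ
  exact congrArg ModuleCat.Hom.hom this

theorem exists_chain_hom {k : ℕ} {M : Type} [AddCommGroup M] [Module ℚ M]
    (c : (singularSet X) _⦋k⦌ → M) :
    ∃ u : (chains X).X k →ₗ[ℚ] M, ∀ σ, u (simplexChain σ) = c σ := by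
  let s : Limits.Cofan (fun (_ : (singularSet X) _⦋k⦌) => ModuleCat.of ℚ ℚ) :=
    Limits.Cofan.mk (ModuleCat.of ℚ M) fun σ =>
      ModuleCat.ofHom (LinearMap.toSpanSingleton ℚ M (c σ))
  let D := ((singularSet X).isColimitChainComplexXCofan (ModuleCat.of ℚ ℚ) k)
  refine ⟨(D.desc s).hom, fun σ => ?_⟩
  have := congrArg (fun g => g.hom (1 : ℚ)) (D.fac s ⟨σ⟩)
  refine this.trans ?_
  exact one_smul ℚ (c σ)

theorem d_simplexChain {k : ℕ} (σ : (singularSet X) _⦋k + 1⦌) :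
    ((chains X).d (k + 1) k).hom (simplexChain σ) =
      ∑ i : Fin (k + 2), (-1 : ℤ) ^ i.val • simplexChain ((singularSet X).δ i σ) := by
  have := congrArg (fun g => g.hom (1 : ℚ))
    (SSet.ιChainComplex_d (singularSet X) (ModuleCat.of ℚ ℚ) σ)
  refine this.trans ?_
  simp [simplexChain, ModuleCat.hom_sum, LinearMap.sum_apply]

/-- The class of a singular `1`-simplex modulo boundaries. -/
noncomputable def simplexClass (σ : (singularSet X) _⦋1⦌) : (chains X).opcycles 1 :=
  ((chains X).pOpcycles 1).hom (simplexChain σ)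

theorem simplexClass_δ (τ : (singularSet X) _⦋2⦌) :
    simplexClass ((singularSet X).δ 1 τ) =
      simplexClass ((singularSet X).δ 2 τ) + simplexClass ((singularSet X).δ 0 τ) := by
  have h : ((chains X).pOpcycles 1).hom (((chains X).d 2 1).hom (simplexChain τ)) = 0 :=
    congrArg (fun g => g.hom (simplexChain τ)) ((chains X).d_pOpcycles 2 1)
  rw [d_simplexChain] at h
  simp only [Fin.sum_univ_succ, Fin.val_zero, pow_zero, one_smul, Fin.val_succ, zero_add, pow_one,
    neg_smul, Finset.univ_unique, Finset.sum_singleton, map_add, map_neg, Fin.default_eq_zero,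
    even_two, Even.neg_pow, one_pow, one_add_one_eq_two, Nat.reduceAdd, Fin.succ_zero_eq_one,
    Fin.succ_one_eq_two] at h
  rw [← sub_eq_zero, ← neg_eq_zero]
  refine Eq.trans ?_ h
  simp only [simplexClass]
  abel

theorem opcycles_hom_ext {M : Type} [AddCommGroup M] [Module ℚ M]
    {u v : (chains X).opcycles 1 →ₗ[ℚ] M} (h : ∀ σ, u (simplexClass σ) = v (simplexClass σ)) :
    u = v := by
  have : (chains X).pOpcycles 1 ≫ ModuleCat.ofHom u = (chains X).pOpcycles 1 ≫ ModuleCat.ofHom v :=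
    ModuleCat.hom_ext (chain_hom_ext h)
  exact congrArg ModuleCat.Hom.hom ((cancel_epi _).1 this)

/-- The additivity condition says exactly that the linear extension of `c` kills boundaries of
2-simplices. -/
theorem exists_opcycles_hom {M : Type} [AddCommGroup M] [Module ℚ M]
    (c : (singularSet X) _⦋1⦌ → M)
    (hc : ∀ τ : (singularSet X) _⦋2⦌, c ((singularSet X).δ 1 τ) =
      c ((singularSet X).δ 2 τ) + c ((singularSet X).δ 0 τ)) :
    ∃ u : (chains X).opcycles 1 →ₗ[ℚ] M, ∀ σ, u (simplexClass σ) = c σ := by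
  obtain ⟨u, hu⟩ := exists_chain_hom c
  have h0 : (chains X).d 2 1 ≫ ModuleCat.ofHom u = 0 := by
    refine ModuleCat.hom_ext (chain_hom_ext fun τ => ?_)
    change u (((chains X).d 2 1).hom (simplexChain τ)) = 0
    rw [d_simplexChain]
    simp [Fin.sum_univ_succ, hu, hc]
  refine ⟨((chains X).descOpcycles (ModuleCat.ofHom u) 2 (by simp) h0).hom, fun σ => ?_⟩
  have := congrArg (fun g => g.hom (simplexChain σ))
    ((chains X).p_descOpcycles (ModuleCat.ofHom u) 2 (by simp) h0)
  exact this.trans (hu σ)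

/-- The boundary map on `1`-chains modulo boundaries. -/
noncomputable def bdry (X : Type) [TopologicalSpace X] :
    (chains X).opcycles 1 →ₗ[ℚ] (chains X).X 0 :=
  ((chains X).fromOpcycles 1 0).hom

theorem bdry_simplexClass (σ : (singularSet X) _⦋1⦌) :
    bdry X (simplexClass σ) =
      simplexChain ((singularSet X).δ 0 σ) - simplexChain ((singularSet X).δ 1 σ) := by
  have := congrArg (fun g => g.hom (simplexChain σ)) ((chains X).p_fromOpcycles 1 0)
  refine this.trans ?_
  rw [d_simplexChain]
  simp [sub_eq_add_neg]

/-- First homology as a subspace of `1`-chains modulo boundaries. -/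
noncomputable def homologyIncl (X : Type) [TopologicalSpace X] :
    (chains X).homology 1 →ₗ[ℚ] (chains X).opcycles 1 :=
  ((chains X).homologyι 1).hom

theorem homologyIncl_injective : Function.Injective (homologyIncl X) :=
  (ModuleCat.mono_iff_injective _).1 inferInstance

theorem bdry_homologyIncl (x : (chains X).homology 1) : bdry X (homologyIncl X x) = 0 :=
  congrArg (fun g => g.hom x) ((chains X).homologyι_comp_fromOpcycles 1 0)

theorem exists_homologyIncl_eq {q : (chains X).opcycles 1} (hq : bdry X q = 0) :
    ∃ x, homologyIncl X x = q := by
  have h := (chains X).homologyIsKernel 1 0 (by simp)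
  let u : ModuleCat.of ℚ ℚ ⟶ (chains X).opcycles 1 :=
    ModuleCat.ofHom (LinearMap.toSpanSingleton ℚ _ q)
  have hu : u ≫ (chains X).fromOpcycles 1 0 = 0 := by
    refine ModuleCat.hom_ext (LinearMap.ext_ring ?_)
    change bdry X ((1 : ℚ) • q) = 0
    rw [one_smul, hq]
  obtain ⟨l, hl⟩ := Limits.KernelFork.IsLimit.lift' h u hu
  refine ⟨l.hom (1 : ℚ), ?_⟩
  have := congrArg (fun g => g.hom (1 : ℚ)) hl
  exact this.trans (one_smul ℚ q)

/-- The action of a continuous map on `1`-chains modulo boundaries. -/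
noncomputable def opcyclesPush (f : C(X, Y)) :
    (chains X).opcycles 1 →ₗ[ℚ] (chains Y).opcycles 1 :=
  (opcyclesMap (SSet.chainComplexMap (singularMap f) (ModuleCat.of ℚ ℚ)) 1).hom

theorem opcyclesPush_simplexClass (f : C(X, Y)) (σ : (singularSet X) _⦋1⦌) :
    opcyclesPush f (simplexClass σ) = simplexClass ((singularMap f).app _ σ) := by
  have h1 := congrArg (fun g => g.hom (simplexChain σ))
    (p_opcyclesMap (SSet.chainComplexMap (singularMap f) (ModuleCat.of ℚ ℚ)) 1)
  have h2 := congrArg (fun g => g.hom (1 : ℚ))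
    (SSet.ι_chainComplexMap_f _ _ (singularMap f) (ModuleCat.of ℚ ℚ) σ)
  exact h1.trans (congrArg ((chains Y).pOpcycles 1).hom h2)

theorem homologyIncl_homologyMap (f : C(X, X)) (x : (chains X).homology 1) :
    homologyIncl X (homologyMap f 1 x) = opcyclesPush f (homologyIncl X x) :=
  congrArg (fun g => g.hom x)
    (homologyι_naturality (SSet.chainComplexMap (singularMap f) (ModuleCat.of ℚ ℚ)) 1)

/-- A barycentric coordinate on the standard simplex. -/
def coord (k : ℕ) (i : Fin (k + 1)) : C(stdSimplex ℝ (Fin (k + 1)), ℝ) :=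
  ⟨fun x => x.1 i, (continuous_apply i).comp continuous_subtype_val⟩

/-- The continuous map underlying a singular simplex. -/
noncomputable def simplexMap (X : Type) [TopologicalSpace X] (k : ℕ) :
    (singularSet X) _⦋k⦌ ≃ C(stdSimplex ℝ (Fin (k + 1)), X) :=
  TopCat.toSSetObjEquiv (TopCat.of X) (.op ⦋k⦌)

/-- The singular `1`-simplex given by the restriction of a path to `[0,1]`. -/
noncomputable def edge (p : C(ℝ, X)) : (singularSet X) _⦋1⦌ :=
  (simplexMap X 1).symm (p.comp (coord 1 1))

/-- The singular `2`-simplex with vertices `(0,0)`, `(1,0)`, `(1,1)` in the plane. -/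
noncomputable def triangle (F : C(ℝ × ℝ, X)) : (singularSet X) _⦋2⦌ :=
  (simplexMap X 2).symm (F.comp ((coord 2 1 + coord 2 2).prodMk (coord 2 2)))

theorem simplexMap_δ {k : ℕ} (i : Fin (k + 2)) (τ : (singularSet X) _⦋k + 1⦌) :
    simplexMap X k ((singularSet X).δ i τ) = (simplexMap X (k + 1) τ).comp
      ⟨stdSimplex.map (SimplexCategory.δ i), stdSimplex.continuous_map _⟩ :=
  rfl

theorem edge_eq_iff (p : C(ℝ, X)) (σ : (singularSet X) _⦋1⦌) :
    edge p = σ ↔ ∀ x, p (coord 1 1 x) = simplexMap X 1 σ x := by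
  rw [edge, Equiv.symm_apply_eq, ContinuousMap.ext_iff]
  rfl

theorem coord_mem (k : ℕ) (i : Fin (k + 1)) (x) : coord k i x ∈ Set.Icc (0 : ℝ) 1 :=
  mem_Icc_of_mem_stdSimplex x.2 i

theorem edge_congr {p q : C(ℝ, X)} (h : ∀ t ∈ Set.Icc (0 : ℝ) 1, p t = q t) : edge p = edge q :=
  (edge_eq_iff _ _).2 fun x => h _ (coord_mem _ _ x)

theorem edge_inj {p q : C(ℝ, X)} (h : edge p = edge q) : ∀ t ∈ Set.Icc (0 : ℝ) 1, p t = q t := by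
  intro t ht
  have h1 := (edge_eq_iff _ _).1 h (stdSimplexHomeomorphUnitInterval.symm ⟨t, ht⟩)
  exact h1

/-- Paths live on the whole line, but only their values on `[0,1]` matter; a simplex is extended by
constants. -/
theorem exists_edge_eq (σ : (singularSet X) _⦋1⦌) : ∃ p : C(ℝ, X), edge p = σ := by
  let r : C(ℝ, stdSimplex ℝ (Fin 2)) :=
    ⟨fun t => stdSimplexHomeomorphUnitInterval.symm (Set.projIcc 0 1 zero_le_one t), by fun_prop⟩
  refine ⟨(simplexMap X 1 σ).comp r, (edge_eq_iff _ _).2 fun x => congrArg (simplexMap X 1 σ) ?_⟩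
  refine Eq.trans ?_ (stdSimplexHomeomorphUnitInterval.symm_apply_apply x)
  exact congrArg stdSimplexHomeomorphUnitInterval.symm (Set.projIcc_of_mem _ (coord_mem 1 1 x))

theorem coord_add (x : stdSimplex ℝ (Fin 2)) : coord 1 0 x + coord 1 1 x = 1 :=
  stdSimplex.add_eq_one x

/-- A face inclusion into the standard `2`-simplex. -/
noncomputable def faceMap (i : Fin 3) : C(stdSimplex ℝ (Fin 2), stdSimplex ℝ (Fin 3)) :=
  ⟨stdSimplex.map (SimplexCategory.δ i), stdSimplex.continuous_map _⟩

theorem coord_faceMap (i j : Fin 3) (x : stdSimplex ℝ (Fin 2)) :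
    coord 2 j (faceMap i x) = (if Fin.succAbove i 0 = j then coord 1 0 x else 0) +
      if Fin.succAbove i 1 = j then coord 1 1 x else 0 := by
  change stdSimplex.map (SimplexCategory.δ i) x j = _
  rw [stdSimplex.map_coe, FunOnFinite.linearMap_apply_apply, Finset.sum_filter, Fin.sum_univ_two]
  rfl

theorem coord_faceMap_zero (x : stdSimplex ℝ (Fin 2)) :
    (fun j => coord 2 j (faceMap 0 x)) = ![0, coord 1 0 x, coord 1 1 x] := by
  funext j
  rw [coord_faceMap]
  fin_cases j <;> simp [Fin.succAbove]

theorem coord_faceMap_one (x : stdSimplex ℝ (Fin 2)) :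
    (fun j => coord 2 j (faceMap 1 x)) = ![coord 1 0 x, 0, coord 1 1 x] := by
  funext j
  rw [coord_faceMap]
  fin_cases j <;> simp [Fin.succAbove]

theorem coord_faceMap_two (x : stdSimplex ℝ (Fin 2)) :
    (fun j => coord 2 j (faceMap 2 x)) = ![coord 1 0 x, coord 1 1 x, 0] := by
  funext j
  rw [coord_faceMap]
  fin_cases j <;> simp [Fin.succAbove]

theorem triangle_δ (F : C(ℝ × ℝ, X)) (i : Fin 3) (p : C(ℝ, X))
    (h : ∀ x, p (coord 1 1 x) =
      F (coord 2 1 (faceMap i x) + coord 2 2 (faceMap i x), coord 2 2 (faceMap i x))) :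
    (singularSet X).δ i (triangle F) = edge p := by
  refine ((edge_eq_iff _ _).2 fun x => ?_).symm
  rw [simplexMap_δ, triangle, Equiv.apply_symm_apply, h]
  rfl

/-- The class modulo boundaries of the restriction of a path to `[0,1]`. -/
noncomputable def pathClass (p : C(ℝ, X)) : (chains X).opcycles 1 := simplexClass (edge p)

theorem pathClass_congr {p q : C(ℝ, X)} (h : ∀ t ∈ Set.Icc (0 : ℝ) 1, p t = q t) :
    pathClass p = pathClass q := by
  rw [pathClass, pathClass, edge_congr h]

/-- The faces of `triangle F` are the diagonal, the bottom side and the right side of the unit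
square. -/
theorem pathClass_triangle (F : C(ℝ × ℝ, X)) :
    pathClass (F.comp ((ContinuousMap.id ℝ).prodMk (ContinuousMap.id ℝ))) =
      pathClass (F.comp ((ContinuousMap.id ℝ).prodMk (ContinuousMap.const ℝ 0))) +
        pathClass (F.comp ((ContinuousMap.const ℝ 1).prodMk (ContinuousMap.id ℝ))) := by
  have h := simplexClass_δ (triangle F)
  rw [triangle_δ F 0 (F.comp ((ContinuousMap.const ℝ 1).prodMk (ContinuousMap.id ℝ))),
    triangle_δ F 1 (F.comp ((ContinuousMap.id ℝ).prodMk (ContinuousMap.id ℝ))),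
    triangle_δ F 2 (F.comp ((ContinuousMap.id ℝ).prodMk (ContinuousMap.const ℝ 0)))] at h
  · exact h
  · intro x
    have h1 : coord 2 1 (faceMap 2 x) = coord 1 1 x := congrFun (coord_faceMap_two x) 1
    have h2 : coord 2 2 (faceMap 2 x) = 0 := congrFun (coord_faceMap_two x) 2
    rw [h1, h2, add_zero]
    rfl
  · intro x
    have h1 : coord 2 1 (faceMap 1 x) = 0 := congrFun (coord_faceMap_one x) 1
    have h2 : coord 2 2 (faceMap 1 x) = coord 1 1 x := congrFun (coord_faceMap_one x) 2
    rw [h1, h2, zero_add]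
    rfl
  · intro x
    have h1 : coord 2 1 (faceMap 0 x) = coord 1 0 x := congrFun (coord_faceMap_zero x) 1
    have h2 : coord 2 2 (faceMap 0 x) = coord 1 1 x := congrFun (coord_faceMap_zero x) 2
    rw [h1, h2, coord_add]
    rfl

theorem pathClass_const (x : X) : pathClass (ContinuousMap.const ℝ x) = 0 := by
  have := pathClass_triangle (ContinuousMap.const (ℝ × ℝ) x)
  simpa using this

/-- The restriction of a path to `[a,b]`, reparametrized by `[0,1]`. -/
def subpath (p : C(ℝ, X)) (a b : ℝ) : C(ℝ, X) :=
  p.comp ⟨fun t => a + t * (b - a), by fun_prop⟩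

theorem subpath_apply (p : C(ℝ, X)) (a b t : ℝ) : subpath p a b t = p (a + t * (b - a)) := rfl

theorem pathClass_subpath_trans (p : C(ℝ, X)) (a b c : ℝ) :
    pathClass (subpath p a c) = pathClass (subpath p a b) + pathClass (subpath p b c) := by
  have h := pathClass_triangle
    (p.comp ⟨fun z : ℝ × ℝ => a + z.1 * (b - a) + z.2 * (c - b), by fun_prop⟩)
  refine Eq.trans (congrArg _ ?_) (h.trans (congrArg₂ _ (congrArg _ ?_) (congrArg _ ?_)))
  all_goals
    refine ContinuousMap.ext fun t => congrArg p ?_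
    simp
  ring

/-- Both sides equal the class of the diagonal, by the two triangles into which it cuts the square.
-/
theorem pathClass_square (F : C(ℝ × ℝ, X)) :
    pathClass (F.comp ((ContinuousMap.id ℝ).prodMk (ContinuousMap.const ℝ 0))) +
        pathClass (F.comp ((ContinuousMap.const ℝ 1).prodMk (ContinuousMap.id ℝ))) =
      pathClass (F.comp ((ContinuousMap.const ℝ 0).prodMk (ContinuousMap.id ℝ))) +
        pathClass (F.comp ((ContinuousMap.id ℝ).prodMk (ContinuousMap.const ℝ 1))) := by
  rw [← pathClass_triangle]
  exact pathClass_triangle (F.comp ContinuousMap.prodSwap)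

theorem opcyclesPush_pathClass (f : C(X, Y)) (p : C(ℝ, X)) :
    opcyclesPush f (pathClass p) = pathClass (f.comp p) :=
  opcyclesPush_simplexClass f (edge p)

theorem pathClass_hom_ext {M : Type} [AddCommGroup M] [Module ℚ M]
    {u v : (chains X).opcycles 1 →ₗ[ℚ] M} (h : ∀ p, u (pathClass p) = v (pathClass p)) :
    u = v := by
  refine opcycles_hom_ext fun σ => ?_
  obtain ⟨p, rfl⟩ := exists_edge_eq σ
  exact h p

/-- The singular `0`-chain given by a point. -/
noncomputable def pointChain (x : X) : (chains X).X 0 :=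
  simplexChain ((simplexMap X 0).symm (ContinuousMap.const _ x))

theorem exists_pointChain_hom {M : Type} [AddCommGroup M] [Module ℚ M] (c : X → M) :
    ∃ u : (chains X).X 0 →ₗ[ℚ] M, ∀ x, u (pointChain x) = c x := by
  obtain ⟨u, hu⟩ := exists_chain_hom fun σ => c (simplexMap X 0 σ (stdSimplex.vertex 0))
  exact ⟨u, fun x => (hu _).trans (by simp)⟩

theorem edge_δ_zero (p : C(ℝ, X)) : (singularSet X).δ 0 (edge p) =
    (simplexMap X 0).symm (ContinuousMap.const _ (p 1)) := by
  rw [Equiv.eq_symm_apply, simplexMap_δ]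
  refine ContinuousMap.ext fun x => congrArg p ?_
  change stdSimplex.map (SimplexCategory.δ 0) x 1 = _
  rw [stdSimplex.map_coe, FunOnFinite.linearMap_apply_apply, Finset.sum_filter]
  refine Eq.trans ?_ (x.2.2)
  exact Finset.sum_congr rfl fun k _ => if_pos (by fin_cases k; rfl)

theorem edge_δ_one (p : C(ℝ, X)) : (singularSet X).δ 1 (edge p) =
    (simplexMap X 0).symm (ContinuousMap.const _ (p 0)) := by
  rw [Equiv.eq_symm_apply, simplexMap_δ]
  refine ContinuousMap.ext fun x => congrArg p ?_
  change stdSimplex.map (SimplexCategory.δ 1) x 1 = _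
  rw [stdSimplex.map_coe, FunOnFinite.linearMap_apply_apply, Finset.sum_filter]
  exact Finset.sum_eq_zero fun k _ => if_neg (by fin_cases k; decide)

theorem bdry_pathClass (p : C(ℝ, X)) :
    bdry X (pathClass p) = pointChain (p 1) - pointChain (p 0) := by
  rw [pathClass, bdry_simplexClass, edge_δ_zero, edge_δ_one]
  rfl

end SingularOne

end

/-! ### Winding functionals, traces, and zeroth homology -/

section

open CategoryTheory AlgebraicTopology Simplicial HomologicalComplex

namespace SingularOne

variable {X Y : Type} [TopologicalSpace X] [TopologicalSpace Y]

theorem exists_lift_addCircle {A : Type} [TopologicalSpace A] [SimplyConnectedSpace A]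
    [LocallyPathConnectedSpace A] (q : C(A, AddCircle (1 : ℝ))) :
    ∃ L : C(A, ℝ), ∀ a, (L a : AddCircle (1 : ℝ)) = q a := by
  obtain ⟨a₀⟩ : Nonempty A := inferInstance
  obtain ⟨e₀, he⟩ := QuotientAddGroup.mk_surjective (q a₀)
  obtain ⟨L, ⟨-, hL⟩, -⟩ :=
    (AddCircle.isCoveringMap_coe (1 : ℝ)).existsUnique_continuousMap_lifts q a₀ e₀ he
  exact ⟨L, congrFun hL⟩

/-- Two lifts of one path differ by a constant: the shift of `L'` that agrees with `L` at `a` is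
again a lift, and lifts are unique. -/
theorem lift_sub_lift_eq {L L' : ℝ → ℝ} {s : Set ℝ} (hs : _root_.IsPreconnected s)
    (hL : ContinuousOn L s) (hL' : ContinuousOn L' s)
    (h : ∀ t ∈ s, (L t : AddCircle (1 : ℝ)) = L' t) {a b : ℝ} (ha : a ∈ s) (hb : b ∈ s) :
    L b - L a = L' b - L' a := by
  have h0 : ((L a - L' a : ℝ) : AddCircle (1 : ℝ)) = 0 := by
    rw [AddCircle.coe_sub, h a ha, sub_self]
  have := (AddCircle.isCoveringMap_coe (1 : ℝ)).eqOn_of_comp_eqOn hs hL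
    (hL'.add (continuousOn_const (c := L a - L' a))) (fun t ht => by
      change (L t : AddCircle (1 : ℝ)) = ((L' t + (L a - L' a) : ℝ) : AddCircle (1 : ℝ))
      rw [AddCircle.coe_add, h0, add_zero, h t ht]) ha (by simp) hb
  rw [Pi.add_apply] at this
  linarith

/-- A map from the square onto the `2`-simplex that collapses one edge. -/
noncomputable def squareToSimplex : C(ℝ × ℝ, stdSimplex ℝ (Fin 3)) where
  toFun z :=
    let s : ℝ := Set.projIcc (0 : ℝ) 1 zero_le_one z.1
    let t : ℝ := Set.projIcc (0 : ℝ) 1 zero_le_one z.2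
    ⟨![1 - s, s * (1 - t), s * t], by
      have hs := (Set.projIcc (0 : ℝ) 1 zero_le_one z.1).2
      have ht := (Set.projIcc (0 : ℝ) 1 zero_le_one z.2).2
      refine ⟨fun i => ?_, ?_⟩
      · fin_cases i
        · exact sub_nonneg.2 hs.2
        · exact mul_nonneg hs.1 (sub_nonneg.2 ht.2)
        · exact mul_nonneg hs.1 ht.1
      · simp [Fin.sum_univ_three]
        ring⟩
  continuous_toFun := by
    refine Continuous.subtype_mk (continuous_pi fun i => ?_) _
    fin_cases i <;> simp <;> fun_prop

theorem edge_comp_squareToSimplex (τ : (singularSet X) _⦋2⦌) (i : Fin 3) (u : C(ℝ, ℝ × ℝ))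
    (h : ∀ x, (fun j => coord 2 j (squareToSimplex (u (coord 1 1 x)))) =
      fun j => coord 2 j (faceMap i x)) :
    edge (((simplexMap X 2 τ).comp squareToSimplex).comp u) = (singularSet X).δ i τ := by
  refine (edge_eq_iff _ _).2 fun x => ?_
  rw [simplexMap_δ]
  exact congrArg (simplexMap X 2 τ) (Subtype.ext (h x))

theorem coord_squareToSimplex {s t : ℝ} (hs : s ∈ Set.Icc (0 : ℝ) 1) (ht : t ∈ Set.Icc (0 : ℝ) 1) :
    (fun j => coord 2 j (squareToSimplex (s, t))) = ![1 - s, s * (1 - t), s * t] := by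
  have h : (fun j => coord 2 j (squareToSimplex (s, t))) =
    ![1 - (Set.projIcc (0 : ℝ) 1 zero_le_one s : ℝ),
      (Set.projIcc (0 : ℝ) 1 zero_le_one s : ℝ) * (1 - (Set.projIcc (0 : ℝ) 1 zero_le_one t : ℝ)),
      (Set.projIcc (0 : ℝ) 1 zero_le_one s : ℝ) * (Set.projIcc (0 : ℝ) 1 zero_le_one t : ℝ)] := rfl
  rw [h, Set.projIcc_of_mem _ hs, Set.projIcc_of_mem _ ht]

/-- The functional on `1`-chains modulo boundaries that measures the variation of a lift of
`r ∘ p` to the line. -/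
theorem exists_winding (r : C(X, AddCircle (1 : ℝ))) :
    ∃ u : (chains X).opcycles 1 →ₗ[ℚ] ℝ, ∀ (p : C(ℝ, X)) (L : ℝ → ℝ),
      ContinuousOn L (Set.Icc 0 1) →
      (∀ t ∈ Set.Icc (0 : ℝ) 1, (L t : AddCircle (1 : ℝ)) = r (p t)) →
      u (pathClass p) = L 1 - L 0 := by
  -- The functional is defined with chosen representatives and lifts; `key` shows that the choices
  -- are immaterial.
  choose P hP using exists_edge_eq (X := X)
  choose Λ hΛ using fun p : C(ℝ, X) => exists_lift_addCircle (r.comp p)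
  have key : ∀ (p : C(ℝ, X)) (L : ℝ → ℝ), ContinuousOn L (Set.Icc 0 1) →
      (∀ t ∈ Set.Icc (0 : ℝ) 1, (L t : AddCircle (1 : ℝ)) = r (p t)) →
      Λ (P (edge p)) 1 - Λ (P (edge p)) 0 = L 1 - L 0 := fun p L hL h =>
    lift_sub_lift_eq (isPreconnected_Icc (a := (0 : ℝ)) (b := 1))
      (Λ (P (edge p))).continuous.continuousOn hL
      (fun t ht => by rw [hΛ, h t ht, ContinuousMap.comp_apply, edge_inj (hP (edge p)) t ht])
      (Set.left_mem_Icc.2 zero_le_one) (Set.right_mem_Icc.2 zero_le_one)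
  obtain ⟨u, hu⟩ := exists_opcycles_hom (fun σ => Λ (P σ) 1 - Λ (P σ) 0) (fun τ => by
    -- Additivity on `τ`: pulled back to the plane, `r ∘ τ` has one global lift. Three sides of the
    -- square are the faces of `τ`; the fourth is collapsed to a vertex and contributes no
    -- variation.
    obtain ⟨L, hL⟩ := exists_lift_addCircle (r.comp ((simplexMap X 2 τ).comp squareToSimplex))
    have h1 : ∀ x, 1 - coord 1 1 x = coord 1 0 x := fun x => by rw [← coord_add x]; ring
    have h01 : (0 : ℝ) ∈ Set.Icc (0 : ℝ) 1 := Set.left_mem_Icc.2 zero_le_one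
    have h11 : (1 : ℝ) ∈ Set.Icc (0 : ℝ) 1 := Set.right_mem_Icc.2 zero_le_one
    rw [← edge_comp_squareToSimplex τ 0
        ((ContinuousMap.const ℝ 1).prodMk (ContinuousMap.id ℝ)) (fun x => by
          rw [coord_faceMap_zero]
          refine (coord_squareToSimplex h11 (coord_mem _ _ _)).trans ?_
          simp [h1]),
      ← edge_comp_squareToSimplex τ 1
        ((ContinuousMap.id ℝ).prodMk (ContinuousMap.const ℝ 1)) (fun x => by
          rw [coord_faceMap_one]
          refine (coord_squareToSimplex (coord_mem _ _ _) h11).trans ?_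
          simp [h1]),
      ← edge_comp_squareToSimplex τ 2
        ((ContinuousMap.id ℝ).prodMk (ContinuousMap.const ℝ 0)) (fun x => by
          rw [coord_faceMap_two]
          refine (coord_squareToSimplex (coord_mem _ _ _) h01).trans ?_
          simp [h1])]
    rw [key _ (fun t => L (t, 1)) (by fun_prop) (fun t _ => hL (t, 1)),
      key _ (fun t => L (t, 0)) (by fun_prop) (fun t _ => hL (t, 0)),
      key _ (fun t => L (1, t)) (by fun_prop) (fun t _ => hL (1, t))]
    have h0 := lift_sub_lift_eq (L := fun t => L (0, t)) (L' := fun _ => L (0, 0))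
      (isPreconnected_Icc (a := 0) (b := 1)) (by fun_prop) (by fun_prop)
      (fun t ht => by
        rw [hL, hL]
        refine congrArg (fun y => r (simplexMap X 2 τ y)) (Subtype.ext ?_)
        refine (coord_squareToSimplex h01 ht).trans
          (Eq.trans ?_ (coord_squareToSimplex h01 h01).symm)
        simp) h01 h11
    linarith)
  exact ⟨u, fun p L hL h => (hu _).trans (key p L hL h)⟩

/-- The trace of an endomorphism, from a spanning family and a biorthogonal family of functionals
with values in a larger field. -/
theorem trace_eq_sum_of_biorthogonal {W : Type} [AddCommGroup W] [Module ℚ W] {n : ℕ}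
    (e : Fin n → W) (he : ⊤ ≤ Submodule.span ℚ (Set.range e)) (φ : Fin n → W →ₗ[ℚ] ℝ)
    (h : ∀ i j, φ i (e j) = if i = j then 1 else 0) (T : W →ₗ[ℚ] W) :
    ((LinearMap.trace ℚ W T : ℚ) : ℝ) = ∑ i, φ i (T (e i)) := by
  -- The `φ i` recover rational coefficients, so the spanning family is a basis and the `φ i` are
  -- its coordinates.
  have key : ∀ (c : Fin n → ℚ) i, φ i (∑ j, c j • e j) = c i := fun c i => by
    simp [map_sum, h, Rat.smul_def]
  have hli : LinearIndependent ℚ e := by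
    rw [Fintype.linearIndependent_iff]
    intro c hc i
    have := key c i
    rw [hc, map_zero] at this
    exact_mod_cast this.symm
  let b := Module.Basis.mk hli he
  rw [LinearMap.trace_eq_matrix_trace ℚ b, Matrix.trace]
  push_cast
  refine Finset.sum_congr rfl fun i _ => ?_
  have hb : ∀ j, b j = e j := fun j => by simp [b]
  rw [Matrix.diag_apply, LinearMap.toMatrix_apply, hb]
  conv_rhs => rw [← b.sum_repr (T (e i))]
  simp_rw [hb]
  rw [key]

/-- The augmentation of the zeroth homology. -/
noncomputable def augmentation (X : Type) [TopologicalSpace X] :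
    (chains X).homology 0 →ₗ[ℚ] ℚ :=
  ((singularSet X).homology₀ε (ModuleCat.of ℚ ℚ)).hom

theorem augmentation_injective [PathConnectedSpace X] :
    Function.Injective (augmentation X) :=
  (ModuleCat.mono_iff_injective ((TopCat.of X).singularHomology₀ε (ModuleCat.of ℚ ℚ))).1
    inferInstance

/-- The class of a `0`-simplex. -/
noncomputable def zeroClass (σ : (singularSet X) _⦋0⦌) : (chains X).homology 0 :=
  ((chains X).liftCycles ((singularSet X).ιChainComplex (R := ModuleCat.of ℚ ℚ) σ) 0
    (by simp) (by simp) ≫ (chains X).homologyπ 0).hom (1 : ℚ)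

theorem augmentation_zeroClass (σ : (singularSet X) _⦋0⦌) : augmentation X (zeroClass σ) = 1 :=
  congrArg (fun g => g.hom (1 : ℚ))
    (SSet.liftCycles_ιChainComplex_homologyπ_homology₀ε (singularSet X) (ModuleCat.of ℚ ℚ) σ)

theorem homologyMap_zeroClass (f : C(X, X)) (σ : (singularSet X) _⦋0⦌) :
    homologyMap f 0 (zeroClass σ) = zeroClass ((singularMap f).app _ σ) := by
  have h : ((chains X).liftCycles ((singularSet X).ιChainComplex (R := ModuleCat.of ℚ ℚ) σ) 0
      (by simp) (by simp) ≫ (chains X).homologyπ 0) ≫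
        HomologicalComplex.homologyMap
          (SSet.chainComplexMap (singularMap f) (ModuleCat.of ℚ ℚ)) 0 =
      (chains X).liftCycles ((singularSet X).ιChainComplex (R := ModuleCat.of ℚ ℚ)
        ((singularMap f).app _ σ)) 0 (by simp) (by simp) ≫ (chains X).homologyπ 0 := by
    rw [Category.assoc, homologyπ_naturality, ← Category.assoc]
    congr 1
    rw [← cancel_mono ((chains X).iCycles 0)]
    simp
  exact congrArg (fun g => g.hom (1 : ℚ)) h

/-- On the zeroth homology of a path connected space all continuous maps act trivially. -/
theorem trace_homologyMap_zero [PathConnectedSpace X] (f : C(X, X)) :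
    LinearMap.trace ℚ _ (homologyMap f 0) = 1 := by
  obtain ⟨x⟩ : Nonempty X := inferInstance
  let σ : (singularSet X) _⦋0⦌ := (simplexMap X 0).symm (ContinuousMap.const _ x)
  have h := trace_eq_sum_of_biorthogonal (W := (chains X).homology 0) (n := 1)
    (fun _ => zeroClass σ) (fun y _ => by
      rw [Set.range_const, Submodule.mem_span_singleton]
      refine ⟨augmentation X y, augmentation_injective ?_⟩
      rw [map_smul, augmentation_zeroClass, smul_eq_mul, mul_one])
    (fun _ => (Algebra.linearMap ℚ ℝ).comp (augmentation X))
    (fun i j => by simp [augmentation_zeroClass, Subsingleton.elim i j]) (homologyMap f 0)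
  have h1 : augmentation X (homologyMap f 0 (zeroClass σ)) = 1 :=
    (congrArg _ (homologyMap_zeroClass f σ)).trans (augmentation_zeroClass _)
  refine Rat.cast_injective (α := ℝ) (h.trans ?_)
  rw [Fin.sum_univ_one]
  exact congrArg (Rat.cast (K := ℝ)) h1

end SingularOne

end

/-! ### First homology of the bouquet and the Lefschetz number -/

section

open CategoryTheory AlgebraicTopology Simplicial HomologicalComplex

namespace Bouquet

open SingularOne Topology

variable {n : ℕ} (G : Bouquet n)

theorem arc_add_int (i : Fin n) (t : ℝ) (k : ℤ) : G.arc i (t + k) = G.arc i t := by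
  simpa using (G.periodic_arc i).int_mul k t

theorem arc_int (i : Fin n) (k : ℤ) : G.arc i k = G.b := by
  rw [← zero_add (k : ℝ), arc_add_int, G.arc_zero]

theorem arc_fract (i : Fin n) (t : ℝ) : G.arc i (Int.fract t) = G.arc i t := by
  conv_rhs => rw [← Int.fract_add_floor t, arc_add_int]

theorem arc_eq_arc_iff {i : Fin n} {s t : ℝ} : G.arc i s = G.arc i t ↔ ∃ k : ℤ, s = t + k := by
  constructor
  · intro h
    rw [← arc_fract, ← arc_fract G i t] at h
    have := G.injOn_arc i ⟨Int.fract_nonneg s, Int.fract_lt_one s⟩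
      ⟨Int.fract_nonneg t, Int.fract_lt_one t⟩ h
    exact ⟨⌊s⌋ - ⌊t⌋, by push_cast; linarith [Int.fract_add_floor s, Int.fract_add_floor t]⟩
  · rintro ⟨k, rfl⟩
    exact G.arc_add_int i t k

theorem arc_eq_b_iff {i : Fin n} {t : ℝ} : G.arc i t = G.b ↔ ∃ k : ℤ, t = k := by
  rw [← G.arc_zero i, arc_eq_arc_iff]
  simp

/-- These are all the identifications that a function defined through parameters has to respect. -/
theorem arc_eq_arc {i j : Fin n} {s t : ℝ} (h : G.arc i s = G.arc j t) :
    (i = j ∧ ∃ k : ℤ, s = t + k) ∨ ((∃ k : ℤ, s = k) ∧ ∃ k : ℤ, t = k) := by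
  by_cases hij : i = j
  · subst hij
    exact Or.inl ⟨rfl, G.arc_eq_arc_iff.1 h⟩
  · have hs := G.eq_b_of_mem_of_mem i j s t hij h
    exact Or.inr ⟨G.arc_eq_b_iff.1 hs, G.arc_eq_b_iff.1 (h ▸ hs)⟩

/-- The parametrization of a circle as a path in the bouquet. -/
noncomputable def loop (i : Fin n) : C(ℝ, G.Space) :=
  ⟨G.pt i, (G.contDiff_arc i).continuous.subtype_mk _⟩

theorem loop_apply (i : Fin n) (t : ℝ) : G.loop i t = G.pt i t := rfl

theorem pt_eq_pt_iff_arc {i j : Fin n} {s t : ℝ} : G.pt i s = G.pt j t ↔ G.arc i s = G.arc j t :=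
  Subtype.ext_iff

theorem pt_add_int (i : Fin n) (t : ℝ) (k : ℤ) : G.pt i (t + k) = G.pt i t :=
  Subtype.ext (G.arc_add_int i t k)

theorem pt_int (i : Fin n) (k : ℤ) : G.pt i k = G.base := Subtype.ext (G.arc_int i k)

theorem pt_eq_base_iff {i : Fin n} {t : ℝ} : G.pt i t = G.base ↔ ∃ k : ℤ, t = k :=
  Subtype.ext_iff.trans G.arc_eq_b_iff

theorem pt_zero (i : Fin n) : G.pt i 0 = G.base := Subtype.ext (G.arc_zero i)

theorem eq_base_or_exists_pt (x : G.Space) :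
    x = G.base ∨ ∃ i, ∃ t ∈ Set.Ioo (0 : ℝ) 1, x = G.pt i t := by
  obtain ⟨x, hx⟩ := x
  rcases hx with hx | hx
  · exact Or.inl (Subtype.ext hx)
  · obtain ⟨i, t, rfl⟩ := Set.mem_iUnion.1 hx
    by_cases h : Int.fract t = 0
    · refine Or.inl (Subtype.ext ?_)
      change G.arc i t = G.b
      rw [← arc_fract, h, G.arc_zero]
    · exact Or.inr ⟨i, Int.fract t, ⟨(Int.fract_nonneg t).lt_of_ne' h, Int.fract_lt_one t⟩,
        Subtype.ext (G.arc_fract i t).symm⟩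

theorem exists_eq_pt [Nonempty (Fin n)] (x : G.Space) :
    ∃ i, ∃ t ∈ Set.Icc (0 : ℝ) 1, x = G.pt i t := by
  rcases G.eq_base_or_exists_pt x with rfl | ⟨i, t, ht, rfl⟩
  · exact ⟨Classical.arbitrary _, 0, ⟨le_rfl, zero_le_one⟩, (G.pt_zero _).symm⟩
  · exact ⟨i, t, ⟨ht.1.le, ht.2.le⟩, rfl⟩

/-- The parametrization of the whole bouquet. -/
noncomputable def param : C(Fin n × ℝ, G.Space) :=
  ⟨fun z => G.pt z.1 z.2, continuous_prod_of_discrete_left.2 fun i => (G.loop i).continuous⟩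

/-- A fundamental domain for the parametrization. -/
def fundamentalDomain (n : ℕ) : Set (Fin n × ℝ) := Set.univ ×ˢ Set.Icc 0 1

theorem isCompact_fundamentalDomain : IsCompact (fundamentalDomain n) :=
  isCompact_univ.prod isCompact_Icc

theorem image_fundamentalDomain [Nonempty (Fin n)] : G.param '' fundamentalDomain n = Set.univ := by
  refine Set.eq_univ_of_forall fun x => ?_
  obtain ⟨i, t, ht, rfl⟩ := G.exists_eq_pt x
  exact ⟨(i, t), ⟨trivial, ht⟩, rfl⟩

/-- Restriction of the parametrization to a compact set, with range the image. -/
noncomputable def paramOn (T : Set (Fin n × ℝ)) : C(T, G.param '' T) :=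
  ⟨fun z => ⟨G.param z, Set.mem_image_of_mem _ z.2⟩, by fun_prop⟩

/-- Properness, unlike being a quotient map, survives the product with `ℝ` needed for homotopies. -/
theorem isProperMap_paramOn {T : Set (Fin n × ℝ)} (hT : IsCompact T) :
    IsProperMap (G.paramOn T) := by
  have := isCompact_iff_compactSpace.1 hT
  exact (G.paramOn T).continuous.isProperMap

theorem surjective_paramOn (T : Set (Fin n × ℝ)) : Function.Surjective (G.paramOn T) := by
  rintro ⟨_, z, hz, rfl⟩
  exact ⟨⟨z, hz⟩, rfl⟩

/-- Collapses every circle but `S_j` to the point 0. The formula respects the identifications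
because integers have class 0, and it descends continuously since the compact fundamental domain
maps onto the bouquet by a quotient map. -/
theorem exists_retraction [Nonempty (Fin n)] (j : Fin n) :
    ∃ r : C(G.Space, AddCircle (1 : ℝ)),
      ∀ i t, r (G.pt i t) = if i = j then (t : AddCircle (1 : ℝ)) else 0 := by
  have hcoe : ∀ k : ℤ, ((k : ℝ) : AddCircle (1 : ℝ)) = 0 := fun k => by
    rw [AddCircle.coe_eq_zero_iff]
    exact ⟨k, by simp⟩
  let c : C(Fin n × ℝ, AddCircle (1 : ℝ)) :=
    ⟨fun z => if z.1 = j then (z.2 : AddCircle (1 : ℝ)) else 0,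
      continuous_prod_of_discrete_left.2 fun i => by
        by_cases h : i = j
        · simpa [h] using AddCircle.continuous_mk' (1 : ℝ)
        · simpa [h] using continuous_const⟩
  have hc : ∀ z w, G.param z = G.param w → c z = c w := by
    rintro ⟨i, s⟩ ⟨i', t⟩ h
    change (if i = j then (s : AddCircle (1 : ℝ)) else 0) =
      if i' = j then (t : AddCircle (1 : ℝ)) else 0
    have h' : G.arc i s = G.arc i' t := G.pt_eq_pt_iff_arc.1 h
    rcases G.arc_eq_arc h' with ⟨rfl, k, rfl⟩ | ⟨⟨k, rfl⟩, l, rfl⟩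
    · rw [AddCircle.coe_add, hcoe, add_zero]
    · rw [hcoe, hcoe, ite_self, ite_self]
  have hq : IsQuotientMap (G.paramOn (fundamentalDomain n)) :=
    (G.isProperMap_paramOn isCompact_fundamentalDomain).isClosedMap.isQuotientMap
      (G.paramOn _).continuous (G.surjective_paramOn _)
  let c₀ : C(fundamentalDomain n, AddCircle (1 : ℝ)) := c.comp ⟨Subtype.val, continuous_subtype_val⟩
  have hc₀ : Function.FactorsThrough c₀ (G.paramOn (fundamentalDomain n)) :=
    fun z w h => hc _ _ (congrArg Subtype.val h)
  let r₀ := hq.lift c₀ hc₀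
  let ι : C(G.Space, G.param '' fundamentalDomain n) :=
    ⟨fun x => ⟨x, by rw [image_fundamentalDomain]; trivial⟩, by fun_prop⟩
  refine ⟨r₀.comp ι, fun i t => ?_⟩
  obtain ⟨z, hz⟩ := G.surjective_paramOn _ (ι (G.pt i t))
  have h1 : r₀ (ι (G.pt i t)) = c z := by
    rw [← hz]
    exact congrFun (congrArg DFunLike.coe (hq.lift_comp c₀ hc₀)) z
  exact h1.trans (hc z (i, t) (congrArg Subtype.val hz))

/-- The part of the bouquet parametrized by `T` contracts to `b` along the arcs, if no nontrivial
identifications are made on `T`. -/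
theorem exists_contraction {T : Set (Fin n × ℝ)} (hT : IsCompact T)
    (hinj : ∀ z ∈ T, ∀ w ∈ T, G.param z = G.param w → z = w ∨ (z.2 = 0 ∧ w.2 = 0)) :
    ∃ H : C((G.param '' T) × ℝ, G.Space), ∀ (i : Fin n) (u s : ℝ) (h : (i, u) ∈ T),
      H (⟨G.pt i u, Set.mem_image_of_mem G.param h⟩, s) = G.pt i (s * u) := by
  let P : C(T × ℝ, (G.param '' T) × ℝ) := (G.paramOn T).prodMap (ContinuousMap.id ℝ)
  have hq : IsQuotientMap P :=
    ((G.isProperMap_paramOn hT).prodMap (Homeomorph.refl ℝ).isProperMap).isClosedMap.isQuotientMap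
      ((G.paramOn T).continuous.prodMap continuous_id)
      ((G.surjective_paramOn T).prodMap Function.surjective_id)
  let c : C(T × ℝ, G.Space) :=
    ⟨fun z => G.param (z.1.1.1, z.2 * z.1.1.2), G.param.continuous.comp (by fun_prop)⟩
  have hc : Function.FactorsThrough c P := by
    rintro ⟨⟨⟨i, u⟩, hz⟩, s⟩ ⟨⟨⟨j, v⟩, hw⟩, s'⟩ h
    obtain rfl : s = s' := congrArg Prod.snd h
    have h1 : G.param (i, u) = G.param (j, v) := congrArg (fun x => x.1.1) h
    change G.pt i (s * u) = G.pt j (s * v)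
    rcases hinj _ hz _ hw h1 with h2 | ⟨h2, h3⟩
    · obtain ⟨rfl, rfl⟩ := Prod.mk.inj h2
      rfl
    · simp only at h2 h3
      rw [h2, h3, mul_zero, pt_zero, pt_zero]
  refine ⟨hq.lift c hc, fun i u s h => ?_⟩
  exact congrFun (congrArg DFunLike.coe (hq.lift_comp c hc)) (⟨(i, u), h⟩, s)

/-- The subspace of chain classes spanned by the loops of the bouquet. -/
noncomputable def loopSpan : Submodule ℚ ((chains G.Space).opcycles 1) :=
  Submodule.span ℚ (Set.range fun i => pathClass (G.loop i))

theorem mkQ_pathClass_loop (i : Fin n) : G.loopSpan.mkQ (pathClass (G.loop i)) = 0 :=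
  (Submodule.Quotient.mk_eq_zero _).2 (Submodule.subset_span ⟨i, rfl⟩)

/-- The class of the standard path from `b` to `G.pt i t`, modulo loops. -/
noncomputable def standardClass (i : Fin n) (t : ℝ) :
    (chains G.Space).opcycles 1 ⧸ G.loopSpan :=
  G.loopSpan.mkQ (pathClass (subpath (G.loop i) 0 t))

theorem standardClass_add_one (i : Fin n) (t : ℝ) :
    G.standardClass i (t + 1) = G.standardClass i t := by
  rw [standardClass, pathClass_subpath_trans _ 0 1 (t + 1), map_add]
  have h1 : subpath (G.loop i) 0 1 = G.loop i :=
    ContinuousMap.ext fun s => by simp [subpath_apply]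
  have h2 : subpath (G.loop i) 1 (t + 1) = subpath (G.loop i) 0 t :=
    ContinuousMap.ext fun s => by
      rw [subpath_apply, subpath_apply]
      have := G.pt_add_int i (0 + s * (t - 0)) 1
      rw [← show 1 + s * (t + 1 - 1) = 0 + s * (t - 0) + (1 : ℤ) by push_cast; ring] at this
      exact this
  rw [h1, h2, mkQ_pathClass_loop, zero_add, standardClass]

theorem standardClass_add_int (i : Fin n) (t : ℝ) (k : ℤ) :
    G.standardClass i (t + k) = G.standardClass i t := by
  have : Function.Periodic (G.standardClass i) 1 := G.standardClass_add_one i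
  simpa using this.int_mul k t

theorem standardClass_int (i : Fin n) (k : ℤ) : G.standardClass i k = 0 := by
  rw [← zero_add (k : ℝ), standardClass_add_int, standardClass]
  have : subpath (G.loop i) 0 0 = ContinuousMap.const ℝ (G.pt i 0) :=
    ContinuousMap.ext fun s => by simp [subpath_apply, loop_apply]
  rw [this, pathClass_const, map_zero]

/-- Modulo loops, extra turns around a circle do not count, so the class depends on the end point
only and defines a potential. -/
theorem standardClass_congr {i j : Fin n} {s t : ℝ} (h : G.pt i s = G.pt j t) :
    G.standardClass i s = G.standardClass j t := by
  rcases G.arc_eq_arc (G.pt_eq_pt_iff_arc.1 h) with ⟨rfl, k, rfl⟩ | ⟨⟨k, rfl⟩, l, rfl⟩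
  · exact G.standardClass_add_int i t k
  · rw [standardClass_int, standardClass_int]

theorem exists_potential [Nonempty (Fin n)] :
    ∃ S : G.Space → (chains G.Space).opcycles 1 ⧸ G.loopSpan,
      ∀ i t, S (G.pt i t) = G.standardClass i t := by
  choose I τ _ h using G.exists_eq_pt
  exact ⟨fun x => G.standardClass (I x) (τ x), fun i t => G.standardClass_congr (h _).symm⟩

/-- Contracting `p` along the arcs gives a square with `p` on top, a constant path at the bottom,
and the standard paths to `p 0` and `p 1` as its vertical sides. -/
theorem mkQ_pathClass_of_mapsTo {T : Set (Fin n × ℝ)} (hT : IsCompact T)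
    (hinj : ∀ z ∈ T, ∀ w ∈ T, G.param z = G.param w → z = w ∨ (z.2 = 0 ∧ w.2 = 0))
    {S : G.Space → (chains G.Space).opcycles 1 ⧸ G.loopSpan}
    (hS : ∀ i t, S (G.pt i t) = G.standardClass i t) (p : C(ℝ, G.Space))
    (hp : ∀ t ∈ Set.Icc (0 : ℝ) 1, p t ∈ G.param '' T) :
    G.loopSpan.mkQ (pathClass p) = S (p 1) - S (p 0) := by
  obtain ⟨H, hH⟩ := G.exists_contraction hT hinj
  have hH' : ∀ x : G.param '' T, ∃ i u, x.1 = G.pt i u ∧ ∀ s, H (x, s) = G.pt i (s * u) := by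
    rintro ⟨_, ⟨i, u⟩, hz, rfl⟩
    exact ⟨i, u, rfl, fun s => hH i u s hz⟩
  let p' : C(ℝ, G.param '' T) :=
    ⟨fun t => ⟨p (Set.projIcc 0 1 zero_le_one t), hp _ (Set.projIcc 0 1 zero_le_one t).2⟩,
      by fun_prop⟩
  have hp' : ∀ t ∈ Set.Icc (0 : ℝ) 1, (p' t).1 = p t := fun t ht => by
    change p (Set.projIcc 0 1 zero_le_one t) = p t
    rw [Set.projIcc_of_mem _ ht]
  have hend : ∀ t ∈ Set.Icc (0 : ℝ) 1, ∀ q : C(ℝ, G.Space), (∀ s, q s = H (p' t, s)) →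
      G.loopSpan.mkQ (pathClass q) = S (p t) := by
    intro t ht q hq
    obtain ⟨i, u, h1, h2⟩ := hH' (p' t)
    rw [← hp' t ht, h1, hS, standardClass]
    refine congrArg _ (congrArg _ (ContinuousMap.ext fun s => ?_))
    rw [hq, h2, subpath_apply]
    simp [loop_apply]
  let F : C(ℝ × ℝ, G.Space) := H.comp ((p'.comp ContinuousMap.fst).prodMk ContinuousMap.snd)
  have h := congrArg G.loopSpan.mkQ (pathClass_square F)
  rw [map_add, map_add,
    hend 1 (by simp) (F.comp ((ContinuousMap.const ℝ 1).prodMk (ContinuousMap.id ℝ))) fun s => rfl,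
    hend 0 (by simp) (F.comp ((ContinuousMap.const ℝ 0).prodMk (ContinuousMap.id ℝ)))
      fun s => rfl] at h
  rw [pathClass_congr (q := ContinuousMap.const ℝ G.base) (fun t _ => by
      obtain ⟨i, u, -, h2⟩ := hH' (p' t)
      refine (h2 0).trans ?_
      rw [zero_mul, pt_zero]
      rfl), pathClass_const, map_zero, zero_add] at h
  rw [pathClass_congr (q := p) (fun t ht => by
      obtain ⟨i, u, h1, h2⟩ := hH' (p' t)
      refine (h2 1).trans ?_
      rw [one_mul, ← h1, hp' t ht])] at h
  rw [h, add_sub_cancel_left]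

/-- Around `b` take the parameters in `[-1/4, 1/4]` on all circles; around another point, an
interval inside `(0,1)` on its circle. Both have length less than 1, which excludes identifications
by shifts. The image is a neighbourhood because a compact set missing `x` covers the rest. -/
theorem exists_nhds_param_image [Nonempty (Fin n)] (x : G.Space) :
    ∃ T : Set (Fin n × ℝ), IsCompact T ∧
      (∀ z ∈ T, ∀ w ∈ T, G.param z = G.param w → z = w ∨ (z.2 = 0 ∧ w.2 = 0)) ∧
      G.param '' T ∈ 𝓝 x := by
  have key : ∀ T T' : Set (Fin n × ℝ), IsCompact T' → G.param '' T ∪ G.param '' T' = Set.univ →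
      x ∉ G.param '' T' → G.param '' T ∈ 𝓝 x := fun T T' hT' h hx => by
    refine Filter.mem_of_superset
      ((hT'.image G.param.continuous).isClosed.isOpen_compl.mem_nhds hx) fun y hy => ?_
    exact ((Set.ext_iff.1 h y).2 trivial).resolve_right hy
  rcases G.eq_base_or_exists_pt x with rfl | ⟨i, t, ht, rfl⟩
  · refine ⟨Set.univ ×ˢ Set.Icc (-1 / 4) (1 / 4), isCompact_univ.prod isCompact_Icc, ?_,
      key _ (Set.univ ×ˢ Set.Icc (1 / 4) (3 / 4)) (isCompact_univ.prod isCompact_Icc) ?_ ?_⟩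
    · rintro ⟨i, s⟩ ⟨-, hs⟩ ⟨j, u⟩ ⟨-, hu⟩ h
      simp only [Set.mem_Icc] at hs hu
      rcases G.arc_eq_arc (G.pt_eq_pt_iff_arc.1 h) with ⟨rfl, k, hk⟩ | ⟨⟨k, hk⟩, l, hl⟩
      · have h1 : (k : ℝ) < 1 := by simp only at hk; linarith
        have h2 : (-1 : ℝ) < k := by simp only at hk; linarith
        have : k = 0 := by
          have : k < 1 := by exact_mod_cast h1
          have : -1 < k := by exact_mod_cast h2
          omega
        left
        simp only [this, Int.cast_zero, add_zero] at hk
        rw [hk]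
      · right
        simp only at hk hl ⊢
        have : ∀ (m : ℤ) (v : ℝ), v = m → -1 / 4 ≤ v → v ≤ 1 / 4 → v = 0 := by
          rintro m _ rfl h1 h2
          have : m < 1 := by exact_mod_cast (by linarith : (m : ℝ) < 1)
          have : -1 < m := by exact_mod_cast (by linarith : (-1 : ℝ) < m)
          have : m = 0 := by omega
          simp [this]
        exact ⟨this k s hk hs.1 hs.2, this l u hl hu.1 hu.2⟩
    · refine Set.eq_univ_of_forall fun y => ?_
      obtain ⟨i, t, ht, rfl⟩ := G.exists_eq_pt y
      rcases le_total t (1 / 4) with h | h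
      · exact Or.inl ⟨(i, t), ⟨trivial, by linarith [ht.1], h⟩, rfl⟩
      · rcases le_total t (3 / 4) with h' | h'
        · exact Or.inr ⟨(i, t), ⟨trivial, h, h'⟩, rfl⟩
        · refine Or.inl ⟨(i, t + (-1 : ℤ)), ⟨trivial, ?_, ?_⟩, G.pt_add_int i t (-1)⟩ <;>
            push_cast <;> linarith [ht.2]
    · rintro ⟨⟨i, t⟩, ⟨-, ht⟩, h⟩
      obtain ⟨k, hk⟩ := G.pt_eq_base_iff.1 h
      simp only [Set.mem_Icc] at hk ht
      subst hk
      have : k < 1 := by exact_mod_cast (by linarith : (k : ℝ) < 1)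
      have : 0 < k := by exact_mod_cast (by linarith : (0 : ℝ) < k)
      omega
  · obtain ⟨h0, h1⟩ := ht
    refine ⟨{i} ×ˢ Set.Icc (t / 2) ((1 + t) / 2), isCompact_singleton.prod isCompact_Icc, ?_,
      key _ ({i}ᶜ ×ˢ Set.Icc 0 1 ∪ {i} ×ˢ (Set.Icc 0 (t / 2) ∪ Set.Icc ((1 + t) / 2) 1)) ?_ ?_ ?_⟩
    · rintro ⟨i', s⟩ ⟨hi, hs⟩ ⟨j, u⟩ ⟨hj, hu⟩ h
      obtain rfl : i' = i := hi
      obtain rfl : j = i' := hj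
      simp only [Set.mem_Icc] at hs hu
      obtain ⟨k, hk⟩ := G.arc_eq_arc_iff.1 (G.pt_eq_pt_iff_arc.1 h)
      have h3 : k < 1 := by exact_mod_cast (by linarith : (k : ℝ) < 1)
      have h4 : -1 < k := by exact_mod_cast (by linarith : (-1 : ℝ) < k)
      have : k = 0 := by omega
      simp only [this, Int.cast_zero, add_zero] at hk
      left
      rw [hk]
    · exact ((Set.toFinite _).isCompact.prod isCompact_Icc).union
        (isCompact_singleton.prod (isCompact_Icc.union isCompact_Icc))
    · refine Set.eq_univ_of_forall fun y => ?_
      obtain ⟨j, s, hs, rfl⟩ := G.exists_eq_pt y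
      by_cases hj : j = i
      · subst hj
        rcases le_total s (t / 2) with h | h
        · exact Or.inr ⟨(j, s), Or.inr ⟨rfl, Or.inl ⟨hs.1, h⟩⟩, rfl⟩
        · rcases le_total s ((1 + t) / 2) with h' | h'
          · exact Or.inl ⟨(j, s), ⟨rfl, h, h'⟩, rfl⟩
          · exact Or.inr ⟨(j, s), Or.inr ⟨rfl, Or.inr ⟨h', hs.2⟩⟩, rfl⟩
      · exact Or.inr ⟨(j, s), Or.inl ⟨hj, hs⟩, rfl⟩
    · rintro ⟨⟨j, s⟩, hz, h⟩
      have hint : ∀ k : ℤ, t ≠ k := by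
        rintro k rfl
        have h3 : k < 1 := by exact_mod_cast h1
        have h4 : 0 < k := by exact_mod_cast h0
        omega
      rcases G.arc_eq_arc (G.pt_eq_pt_iff_arc.1 h) with ⟨hji, k, hk⟩ | ⟨-, l, hl⟩
      · simp only at hk hji
        subst hji
        rcases hz with hz | hz
        · exact hz.1 rfl
        · have hs : s ∈ Set.Icc 0 (t / 2) ∪ Set.Icc ((1 + t) / 2) 1 := hz.2
          have h3 : k < 1 := by
            rcases hs with hs | hs <;>
            exact_mod_cast (by linarith [hs.1, hs.2] : (k : ℝ) < 1)
          have h4 : -1 < k := by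
            rcases hs with hs | hs <;>
            exact_mod_cast (by linarith [hs.1, hs.2] : (-1 : ℝ) < k)
          have : k = 0 := by omega
          simp only [this, Int.cast_zero, add_zero] at hk
          subst hk
          rcases hs with hs | hs <;> linarith [hs.1, hs.2]
      · exact hint l hl

/-- By compactness the path splits into finitely many pieces, each in a contractible patch; the
local formulas telescope. -/
theorem mkQ_pathClass [Nonempty (Fin n)]
    {S : G.Space → (chains G.Space).opcycles 1 ⧸ G.loopSpan}
    (hS : ∀ i t, S (G.pt i t) = G.standardClass i t) (p : C(ℝ, G.Space)) :
    G.loopSpan.mkQ (pathClass p) = S (p 1) - S (p 0) := by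
  choose T hT hinj hnhds using G.exists_nhds_param_image
  have hcov : ∀ t : Set.Icc (0 : ℝ) 1, ∃ x : G.Space,
      t ∈ (fun t : Set.Icc (0 : ℝ) 1 => p t) ⁻¹' interior (G.param '' T x) :=
    fun t => ⟨p t, mem_interior_iff_mem_nhds.2 (hnhds _)⟩
  obtain ⟨t, ht0, hmono, ⟨m, hm⟩, ht⟩ := exists_monotone_Icc_subset_open_cover_Icc
    (c := fun x : G.Space => (fun t : Set.Icc (0 : ℝ) 1 => p t) ⁻¹' interior (G.param '' T x))
    zero_le_one (fun x => isOpen_interior.preimage (by fun_prop))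
    (fun t _ => Set.mem_iUnion.2 (hcov t))
  have key : ∀ k, G.loopSpan.mkQ (pathClass (subpath p 0 (t k))) = S (p (t k)) - S (p 0) := by
    intro k
    induction k with
    | zero =>
      rw [ht0, sub_self]
      have : subpath p 0 0 = ContinuousMap.const ℝ (p 0) :=
        ContinuousMap.ext fun s => by simp [subpath_apply]
      rw [this, pathClass_const, map_zero]
    | succ k ih =>
      obtain ⟨x, hx⟩ := ht k
      have hle : (t k : ℝ) ≤ t (k + 1) := hmono k.le_succ
      rw [pathClass_subpath_trans p 0 (t k) (t (k + 1)), map_add, ih,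
        G.mkQ_pathClass_of_mapsTo (hT x) (hinj x) hS (subpath p (t k) (t (k + 1)))]
      · simp only [subpath_apply, one_mul, zero_mul, add_zero, add_sub_cancel]
        abel
      · intro s hs
        have h1 : (t k : ℝ) ≤ t k + s * (t (k + 1) - t k) := by
          nlinarith [hs.1]
        have h2 : (t k : ℝ) + s * (t (k + 1) - t k) ≤ t (k + 1) := by
          nlinarith [hs.2]
        exact interior_subset (hx (show (⟨t k + s * (t (k + 1) - t k),
          (t k).2.1.trans h1, h2.trans (t (k + 1)).2.2⟩ : Set.Icc (0 : ℝ) 1) ∈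
            Set.Icc (t k) (t (k + 1)) from ⟨h1, h2⟩))
  have h := key m
  rw [hm m le_rfl] at h
  have h1 : subpath p 0 1 = p := ContinuousMap.ext fun s => by simp [subpath_apply]
  simpa only [h1] using h

/-- By the potential formula the quotient map by the loops factors through the boundary, so it kills
cycles. -/
theorem mem_loopSpan_of_bdry_eq_zero [Nonempty (Fin n)] {q : (chains G.Space).opcycles 1}
    (hq : bdry G.Space q = 0) : q ∈ G.loopSpan := by
  obtain ⟨S, hS⟩ := G.exists_potential
  obtain ⟨u, hu⟩ := exists_pointChain_hom S
  have h : G.loopSpan.mkQ = u.comp (bdry G.Space) := pathClass_hom_ext fun p => by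
    rw [LinearMap.comp_apply, bdry_pathClass, map_sub, hu, hu, G.mkQ_pathClass hS]
  rw [← Submodule.Quotient.mk_eq_zero, ← Submodule.mkQ_apply, h, LinearMap.comp_apply, hq, map_zero]

instance [Nonempty (Fin n)] : PathConnectedSpace G.Space := by
  have h : ∀ x, Joined G.base x := fun x => by
    obtain ⟨i, t, -, rfl⟩ := G.exists_eq_pt x
    rw [← G.pt_zero i]
    exact ⟨(PathConnectedSpace.somePath (0 : ℝ) t).map (G.loop i).continuous⟩
  exact ⟨⟨G.base⟩, fun x y => (h x).symm.trans (h y)⟩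

/-- The Lefschetz number of a self-map of a bouquet in terms of lifts to the line. -/
theorem lefschetzNumber_eq [Nonempty (Fin n)] (g : C(G.Space, G.Space))
    (r : Fin n → C(G.Space, AddCircle (1 : ℝ)))
    (hr : ∀ j i t, r j (G.pt i t) = if i = j then (t : AddCircle (1 : ℝ)) else 0)
    (θ : Fin n → C(ℝ, ℝ)) (hθ : ∀ i t, (θ i t : AddCircle (1 : ℝ)) = r i (g (G.pt i t))) :
    ((lefschetzNumber 1 g : ℚ) : ℝ) = 1 - ∑ i, (θ i 1 - θ i 0) := by
  choose w hw using fun j => exists_winding (r j)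
  have hb : ∀ i, bdry G.Space (pathClass (G.loop i)) = 0 := fun i => by
    have := G.pt_int i 1
    rw [Int.cast_one] at this
    rw [bdry_pathClass, loop_apply, loop_apply, this, pt_zero, sub_self]
  choose e he using fun i => exists_homologyIncl_eq (hb i)
  have hspan : ⊤ ≤ Submodule.span ℚ (Set.range e) := fun x _ => by
    have h1 := G.mem_loopSpan_of_bdry_eq_zero (bdry_homologyIncl x)
    have h2 : (Set.range fun i => pathClass (G.loop i)) = homologyIncl G.Space '' Set.range e := by
      rw [← Set.range_comp]
      exact congrArg Set.range (funext fun i => (he i).symm)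
    rw [loopSpan, h2, ← Submodule.map_span] at h1
    obtain ⟨y, hy, hxy⟩ := h1
    rwa [← homologyIncl_injective hxy]
  -- `r j` winds once along loop `j` and is constant along the other loops. Winding functionals are
  -- real-valued on chains, since a path need not be closed.
  have h := trace_eq_sum_of_biorthogonal e hspan (fun j => (w j).comp (homologyIncl G.Space))
    (fun j i => by
      rw [LinearMap.comp_apply, he]
      by_cases hij : i = j
      · rw [hw j _ (fun t => t) continuousOn_id (fun t _ => by rw [loop_apply, hr, if_pos hij]),
          if_pos hij.symm, sub_zero]
      · rw [hw j _ (fun _ => 0) continuousOn_const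
          (fun t _ => by rw [loop_apply, hr, if_neg hij]; rfl), if_neg (Ne.symm hij), sub_zero])
    (homologyMap g 1)
  have h' : ∀ i, (w i).comp (homologyIncl G.Space) (homologyMap g 1 (e i)) = θ i 1 - θ i 0 :=
    fun i => by
      refine (congrArg (w i) (homologyIncl_homologyMap g (e i))).trans ?_
      rw [he, opcyclesPush_pathClass]
      exact hw i _ (θ i) (θ i).continuous.continuousOn fun t _ => hθ i t
  have h1 := h.trans (Finset.sum_congr rfl fun i _ => h' i)
  rw [lefschetzNumber, Finset.sum_range_succ, Finset.sum_range_one, trace_homologyMap_zero]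
  push_cast
  rw [← h1]
  change _ = 1 - ((LinearMap.trace ℚ _ (homologyMap g 1) : ℚ) : ℝ)
  ring

end Bouquet

end

/-! ### Counting integer crossings of real functions -/

section

open Topology Filter

theorem HasDerivAt.eventually_gt_right {ψ : ℝ → ℝ} {d t : ℝ} (h : HasDerivAt ψ d t) (hd : 0 < d) :
    ∀ᶠ s in 𝓝[>] t, ψ t < ψ s := by
  have h1 := (hasDerivAt_iff_tendsto_slope.1 h).eventually (lt_mem_nhds hd)
  filter_upwards [h1.filter_mono (nhdsWithin_mono t fun s hs => ne_of_gt hs), self_mem_nhdsWithin]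
    with s hs hts
  rw [slope_def_field] at hs
  have := (div_pos_iff_of_pos_right (sub_pos.2 hts)).1 hs
  linarith

theorem HasDerivAt.eventually_lt_left {ψ : ℝ → ℝ} {d t : ℝ} (h : HasDerivAt ψ d t) (hd : 0 < d) :
    ∀ᶠ s in 𝓝[<] t, ψ s < ψ t := by
  have h1 := (hasDerivAt_iff_tendsto_slope.1 h).eventually (lt_mem_nhds hd)
  filter_upwards [h1.filter_mono (nhdsWithin_mono t fun s hs => ne_of_lt hs), self_mem_nhdsWithin]
    with s hs hts
  have hts : s < t := hts
  rw [slope_def_field] at hs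
  have h2 := mul_neg_of_pos_of_neg hs (sub_neg.2 hts)
  rw [div_mul_cancel₀ _ (sub_neg.2 hts).ne] at h2
  linarith

namespace UpwardCrossing

variable {ψ : ℝ → ℝ} {a b : ℝ}

/-- Otherwise there would be a last point before some `t'` with `ψ t' < y` at which `ψ ≥ y`; but `ψ
≥ y` persists just to its right, by continuity or by the positive derivative. -/
theorem lt_of_le (hψ : Continuous ψ) {y : ℝ} (ha : ψ a ≠ y) (hb : ψ b ≠ y)
    (hd : ∀ t ∈ Set.Ioo a b, ψ t = y → ∃ d, 0 < d ∧ HasDerivAt ψ d t)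
    {s t : ℝ} (has : a ≤ s) (hst : s < t) (htb : t ≤ b) (hs : y ≤ ψ s) : y < ψ t := by
  by_contra! hcon
  -- If `ψ t = y`, the positive derivative at `t` puts `ψ` below `y` slightly earlier.
  obtain ⟨t', hst', ht'b, ht'⟩ : ∃ t', s < t' ∧ t' ≤ b ∧ ψ t' < y := by
    rcases hcon.lt_or_eq with h | h
    · exact ⟨t, hst, htb, h⟩
    · obtain ⟨d, hd0, hd1⟩ := hd t ⟨has.trans_lt hst, htb.lt_of_ne fun h' => hb (h' ▸ h)⟩ h
      obtain ⟨t', h1, h2⟩ := ((hd1.eventually_lt_left hd0).and (Ioo_mem_nhdsLT hst)).exists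
      exact ⟨t', h2.1, h2.2.le.trans htb, h ▸ h1⟩
  obtain ⟨u, ⟨⟨hu1, hu2⟩, hu3⟩, hu⟩ :=
    (isCompact_Icc.inter_right (isClosed_le continuous_const hψ) :
      IsCompact (Set.Icc s t' ∩ {u | y ≤ ψ u})).exists_isGreatest ⟨s, ⟨le_rfl, hst'.le⟩, hs⟩
  have hu3 : y ≤ ψ u := hu3
  have hut : u < t' := hu2.lt_of_ne fun h => (h ▸ ht').not_ge hu3
  have hev : ∀ᶠ v in 𝓝[>] u, y ≤ ψ v := by
    rcases hu3.lt_or_eq with h | h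
    · exact (hψ.continuousAt.eventually (lt_mem_nhds h)).filter_mono nhdsWithin_le_nhds |>.mono
        fun v hv => le_of_lt hv
    · obtain ⟨d, hd0, hd1⟩ := hd u ⟨(has.trans hu1).lt_of_ne fun h' => ha (h' ▸ h.symm),
        hut.trans_le ht'b⟩ h.symm
      exact (hd1.eventually_gt_right hd0).mono fun v hv => h.le.trans hv.le
  obtain ⟨v, h1, h2⟩ := (hev.and (Ioo_mem_nhdsGT hut)).exists
  exact (hu ⟨⟨hu1.trans h2.1.le, h2.2.le⟩, h1⟩).not_gt h2.1

/-- If a continuous function is increasing wherever it takes an integer value, then it takes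
exactly the integer values between its end values, each of them once. -/
theorem finite_and_ncard (hψ : Continuous ψ) (hab : a < b) (ha : ∀ k : ℤ, ψ a ≠ k)
    (hb : ∀ k : ℤ, ψ b ≠ k)
    (hd : ∀ t ∈ Set.Ioo a b, ∀ k : ℤ, ψ t = k → ∃ d, 0 < d ∧ HasDerivAt ψ d t) :
    {t ∈ Set.Ioo a b | ∃ k : ℤ, ψ t = k}.Finite ∧
      ({t ∈ Set.Ioo a b | ∃ k : ℤ, ψ t = k}.ncard : ℤ) = ⌊ψ b⌋ - ⌊ψ a⌋ := by
  set A := {t ∈ Set.Ioo a b | ∃ k : ℤ, ψ t = k} with hA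
  have key : ∀ (k : ℤ) {s t : ℝ}, a ≤ s → s < t → t ≤ b → k ≤ ψ s → k < ψ t :=
    fun k s t h1 h2 h3 h4 => lt_of_le hψ (ha k) (hb k) (fun t ht h => hd t ht k h) h1 h2 h3 h4
  have hfl : ∀ t ∈ A, ψ t = ⌊ψ t⌋ := by
    rintro t ⟨-, k, hk⟩
    rw [hk, Int.floor_intCast]
  have hinj : Set.InjOn (fun t => ⌊ψ t⌋) A := by
    intro s hs t ht hst
    have hst : ψ s = ψ t := by rw [hfl s hs, hfl t ht]; exact congrArg _ hst
    rcases lt_trichotomy s t with h | h | h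
    · have := key _ hs.1.1.le h ht.1.2.le (hfl s hs).ge
      rw [← hfl s hs, hst] at this
      exact absurd this (lt_irrefl _)
    · exact h
    · have := key _ ht.1.1.le h hs.1.2.le (hfl t ht).ge
      rw [← hfl t ht, hst] at this
      exact absurd this (lt_irrefl _)
  -- Levels in this range are attained by the intermediate value theorem. No others are, since `ψ`
  -- stays strictly above a level once it has reached it.
  have himg : (fun t => ⌊ψ t⌋) '' A = Set.Ioc ⌊ψ a⌋ ⌊ψ b⌋ := by
    ext k
    constructor
    · rintro ⟨t, ht, rfl⟩
      have h1 : (⌊ψ t⌋ : ℝ) < ψ b := key _ ht.1.1.le ht.1.2 le_rfl (hfl t ht).ge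
      refine ⟨?_, Int.le_floor.2 h1.le⟩
      by_contra! hle
      have h2 := key _ le_rfl ht.1.1 ht.1.2.le (Int.le_floor.1 hle)
      rw [← hfl t ht] at h2
      exact lt_irrefl _ h2
    · rintro ⟨h1, h2⟩
      have h1' : ψ a < k := Int.floor_lt.1 h1
      have h2' : (k : ℝ) < ψ b := (Int.le_floor.1 h2).lt_of_ne (hb k).symm
      obtain ⟨t, ht, htk⟩ := intermediate_value_Ioo hab.le hψ.continuousOn ⟨h1', h2'⟩
      exact ⟨t, ⟨ht, k, htk⟩, by simp [htk]⟩
  have hle : ⌊ψ a⌋ ≤ ⌊ψ b⌋ :=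
    Int.le_floor.2 (key _ le_rfl hab le_rfl (Int.floor_le (ψ a))).le
  refine ⟨Set.Finite.of_finite_image (himg ▸ Set.finite_Ioc _ _) hinj, ?_⟩
  rw [← hinj.ncard_image, himg, ← Finset.coe_Ioc, Set.ncard_coe_finset, Int.card_Ioc,
    Int.toNat_of_nonneg (sub_nonneg.2 hle)]

end UpwardCrossing

theorem ne_intCast_of_add_int {x : ℝ} (h : ∀ k : ℤ, x ≠ k) {y : ℝ} {m : ℤ} (hy : y = x + m)
    (k : ℤ) : y ≠ k := fun h' => h (k - m) (by push_cast; linarith)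

theorem ne_intCast_of_floor_lt {x : ℝ} {m : ℤ} (h1 : m < x) (h2 : x < m + 1) (k : ℤ) : x ≠ k := by
  rintro rfl
  have : m < k := by exact_mod_cast h1
  have : k < m + 1 := by exact_mod_cast h2
  omega

section DegreeCount

variable {θ : ℝ → ℝ} {D : ℤ} {ε : ℤ}

/-- The number of coincidences modulo integers of a map of degree `D` with the identity, if the
common starting point is sent to the interior of the circle. -/
theorem finite_and_ncard_of_start_mem (hθ : Continuous θ) (hD : θ 1 = θ 0 + D)
    (hε : ε = 1 ∨ ε = -1) (h0 : ∀ k : ℤ, θ 0 ≠ k)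
    (hd : ∀ t ∈ Set.Ioo (0 : ℝ) 1, ∀ k : ℤ, θ t - t = k →
      ∃ d, HasDerivAt θ d t ∧ 0 < ε * (d - 1)) :
    {t ∈ Set.Ioo (0 : ℝ) 1 | ∃ k : ℤ, θ t - t = k}.Finite ∧
      ({t ∈ Set.Ioo (0 : ℝ) 1 | ∃ k : ℤ, θ t - t = k}.ncard : ℤ) = ε * (D - 1) := by
  have hint : ∀ x : ℝ, (∃ k : ℤ, ε * x = k) ↔ ∃ k : ℤ, x = k := by
    intro x
    rcases hε with rfl | rfl
    · simp
    · constructor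
      · rintro ⟨k, hk⟩; exact ⟨-k, by push_cast at hk ⊢; linarith⟩
      · rintro ⟨k, hk⟩; exact ⟨-k, by push_cast at hk ⊢; linarith⟩
  -- The factor `ε` makes all crossings upward. The end values differ by the integer `ε (D - 1)`,
  -- and so do their floors.
  have h := UpwardCrossing.finite_and_ncard (ψ := fun t => ε * (θ t - t)) (a := 0) (b := 1)
    (by fun_prop) one_pos
    (fun k hk => by
      obtain ⟨m, hm⟩ := (hint _).1 ⟨k, hk⟩
      exact h0 m (by linarith))
    (fun k hk => by
      obtain ⟨m, hm⟩ := (hint _).1 ⟨k, hk⟩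
      exact h0 (m - D + 1) (by push_cast; linarith))
    (fun t ht k hk => by
      obtain ⟨m, hm⟩ := (hint _).1 ⟨k, hk⟩
      obtain ⟨d, h1, h2⟩ := hd t ht m hm
      exact ⟨_, h2, (h1.sub (hasDerivAt_id t)).const_mul _⟩)
  simp only [hint] at h
  refine ⟨h.1, h.2.trans ?_⟩
  rcases hε with rfl | rfl
  · rw [show ((1 : ℤ) : ℝ) * (θ 1 - 1) = ((1 : ℤ) : ℝ) * (θ 0 - 0) + (D - 1 : ℤ) by
      rw [hD]; push_cast; ring, Int.floor_add_intCast]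
    ring
  · rw [show ((-1 : ℤ) : ℝ) * (θ 1 - 1) = ((-1 : ℤ) : ℝ) * (θ 0 - 0) + (-(D - 1) : ℤ) by
      rw [hD]; push_cast; ring, Int.floor_add_intCast]
    ring

/-- The number of coincidences modulo integers of a map of degree `D` with the identity, if the
map is trivial near the common starting point. -/
theorem finite_and_ncard_of_start_trivial (hθ : Continuous θ) (hε : ε = 1 ∨ ε = -1) {N : ℤ}
    (h0 : ∀ᶠ t in 𝓝 0, θ t = N)
    (h1 : ∀ᶠ t in 𝓝 1, θ t = (N : ℝ) + D)
    (hd : ∀ t ∈ Set.Ioo (0 : ℝ) 1, ∀ k : ℤ, θ t - t = k →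
      ∃ d, HasDerivAt θ d t ∧ 0 < ε * (d - 1)) :
    {t ∈ Set.Ioo (0 : ℝ) 1 | ∃ k : ℤ, θ t - t = k}.Finite ∧
      ({t ∈ Set.Ioo (0 : ℝ) 1 | ∃ k : ℤ, θ t - t = k}.ncard : ℤ) = ε * D := by
  have hint : ∀ x : ℝ, (∃ k : ℤ, ε * x = k) ↔ ∃ k : ℤ, x = k := by
    intro x
    rcases hε with rfl | rfl
    · simp
    · constructor
      · rintro ⟨k, hk⟩; exact ⟨-k, by push_cast at hk ⊢; linarith⟩
      · rintro ⟨k, hk⟩; exact ⟨-k, by push_cast at hk ⊢; linarith⟩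
  -- At 0 and 1 the difference `θ t - t` is an integer, so the count is made on `[δ, 1 - δ]`. On the
  -- pieces cut off from `(0,1)`, `θ` is a constant integer and `θ t - t` is never an integer.
  obtain ⟨δ₀, hδ₀, H0⟩ := Metric.eventually_nhds_iff.1 h0
  obtain ⟨δ₁, hδ₁, H1⟩ := Metric.eventually_nhds_iff.1 h1
  obtain ⟨δ, hδ, hδlt⟩ := exists_between (lt_min (lt_min hδ₀ hδ₁) (by norm_num : (0 : ℝ) < 1 / 2))
  obtain ⟨hδlt', hδ2⟩ := lt_min_iff.1 hδlt
  obtain ⟨hδ0, hδ1⟩ := lt_min_iff.1 hδlt'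
  have E0 : ∀ t, 0 ≤ t → t ≤ δ → θ t = N := fun t h h' =>
    H0 (by rw [Real.dist_eq, sub_zero, abs_of_nonneg h]; linarith)
  have E1 : ∀ t, 1 - δ ≤ t → t ≤ 1 → θ t = (N : ℝ) + D := fun t h h' =>
    H1 (by rw [Real.dist_eq, abs_of_nonpos (by linarith)]; linarith)
  have ea : ∀ t, 0 < t → t ≤ δ → ∀ k : ℤ, θ t - t ≠ k := fun t h h' k =>
    ne_intCast_of_floor_lt (m := N - 1) (by rw [E0 t h.le h']; push_cast; linarith)
      (by rw [E0 t h.le h']; push_cast; linarith) k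
  have eb : ∀ t, 1 - δ ≤ t → t < 1 → ∀ k : ℤ, θ t - t ≠ k := fun t h h' k =>
    ne_intCast_of_floor_lt (m := N + D - 1) (by rw [E1 t h h'.le]; push_cast; linarith)
      (by rw [E1 t h h'.le]; push_cast; linarith) k
  have hset : {t ∈ Set.Ioo (0 : ℝ) 1 | ∃ k : ℤ, θ t - t = k} =
      {t ∈ Set.Ioo δ (1 - δ) | ∃ k : ℤ, θ t - t = k} := by
    ext t
    constructor
    · rintro ⟨ht, k, hk⟩
      refine ⟨⟨?_, ?_⟩, k, hk⟩
      · by_contra! h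
        exact ea t ht.1 h k hk
      · by_contra! h
        exact eb t h ht.2 k hk
    · rintro ⟨ht, hk⟩
      exact ⟨⟨by linarith [ht.1], by linarith [ht.2]⟩, hk⟩
  have h := UpwardCrossing.finite_and_ncard (ψ := fun t => ε * (θ t - t)) (a := δ) (b := 1 - δ)
    (by fun_prop) (by linarith)
    (fun k hk => by
      obtain ⟨m, hm⟩ := (hint _).1 ⟨k, hk⟩
      exact ea δ hδ le_rfl m hm)
    (fun k hk => by
      obtain ⟨m, hm⟩ := (hint _).1 ⟨k, hk⟩
      exact eb (1 - δ) le_rfl (by linarith) m hm)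
    (fun t ht k hk => by
      obtain ⟨m, hm⟩ := (hint _).1 ⟨k, hk⟩
      obtain ⟨d, h1, h2⟩ := hd t ⟨by linarith [ht.1], by linarith [ht.2]⟩ m hm
      exact ⟨_, h2, (h1.sub (hasDerivAt_id t)).const_mul _⟩)
  simp only [hint] at h
  rw [hset]
  refine ⟨h.1, h.2.trans ?_⟩
  rw [E0 δ hδ.le le_rfl, E1 (1 - δ) le_rfl (by linarith)]
  rcases hε with rfl | rfl
  · rw [(Int.floor_eq_iff (z := N + D - 1)).2 ⟨by push_cast; linarith, by push_cast; linarith⟩,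
      (Int.floor_eq_iff (z := N - 1)).2 ⟨by push_cast; linarith, by push_cast; linarith⟩]
    ring
  · rw [(Int.floor_eq_iff (z := -N - D)).2 ⟨by push_cast; linarith, by push_cast; linarith⟩,
      (Int.floor_eq_iff (z := -N)).2 ⟨by push_cast; linarith, by push_cast; linarith⟩]
    ring

end DegreeCount

end

/-! ### Fixed points of a self-map that moves the branching point -/

section

open Topology Filter

namespace Bouquet

variable {n : ℕ} (G : Bouquet n)

/-- The derivative of a continuous function can be read off after composition with an arc. -/
theorem hasDerivAt_of_arc_comp {j : Fin n} {v : ℝ → ℝ} {w : ℝ → ℂ} {t d : ℝ}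
    (hv : ContinuousAt v t) (hw : HasDerivAt w (d • deriv (G.arc j) (v t)) t)
    (h : ∀ᶠ u in 𝓝 t, w u = G.arc j (v u)) : HasDerivAt v d t := by
  set z := deriv (G.arc j) (v t) with hz
  have hz0 : z ≠ 0 := G.deriv_arc_ne_zero j _
  -- `Λ` sends the velocity `z` to 1, so `Λ ∘ arc j` is locally invertible on the line, and its
  -- inverse recovers `v` from `Λ ∘ w`.
  let Λ : ℂ →L[ℝ] ℝ := Complex.reCLM.comp (ContinuousLinearMap.mul ℝ ℂ z⁻¹)
  have hΛ : Λ z = 1 := by simp [Λ, hz0]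
  have harc : HasStrictDerivAt (G.arc j) z (v t) :=
    (G.contDiff_arc j).contDiffAt.hasStrictDerivAt one_ne_zero
  have h1 : HasStrictDerivAt (fun s => Λ (G.arc j s)) 1 (v t) := by
    have := Λ.hasStrictFDerivAt.comp_hasStrictDerivAt (v t) harc
    rwa [hΛ] at this
  have h2 : HasDerivAt (fun u => Λ (w u)) d t := by
    have := Λ.hasFDerivAt.comp_hasDerivAt t hw
    rwa [map_smul, hΛ, smul_eq_mul, mul_one] at this
  have h3 := h1.to_localInverse one_ne_zero
  have hwt : Λ (w t) = Λ (G.arc j (v t)) := by rw [h.self_of_nhds]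
  rw [← hwt] at h3
  have h4 := h3.hasDerivAt.comp t h2
  rw [inv_one, one_mul] at h4
  refine h4.congr_of_eventuallyEq ?_
  have h5 := (h1.hasStrictFDerivAt_equiv one_ne_zero).eventually_left_inverse
  filter_upwards [hv.eventually h5, h] with u hu1 hu2
  simp only [Function.comp_apply]
  rw [hu2]
  exact hu1.symm

theorem hasDerivAt_arc (j : Fin n) (s : ℝ) : HasDerivAt (G.arc j) (deriv (G.arc j) s) s :=
  ((G.contDiff_arc j).differentiable one_ne_zero s).hasDerivAt

theorem deriv_arc_add_int (j : Fin n) (s : ℝ) (k : ℤ) :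
    deriv (G.arc j) (s + k) = deriv (G.arc j) s := by
  rw [← deriv_comp_add_const]
  exact congrArg (fun f => deriv f s) (funext fun u => G.arc_add_int j u k)

theorem coe_addCircle_eq_iff {s t : ℝ} :
    (s : AddCircle (1 : ℝ)) = t ↔ ∃ k : ℤ, s = t + k := by
  rw [← sub_eq_zero, ← AddCircle.coe_sub, AddCircle.coe_eq_zero_iff]
  simp only [zsmul_eq_mul, mul_one]
  exact exists_congr fun k => ⟨fun h => by linarith, fun h => by linarith⟩

/-- The point `b` and all other circles go to 0, so a nonzero value determines the point. This turns
fixed point equations into congruences modulo 1. -/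
theorem eq_pt_of_retraction {r : C(G.Space, AddCircle (1 : ℝ))} {j : Fin n}
    (hr : ∀ i t, r (G.pt i t) = if i = j then (t : AddCircle (1 : ℝ)) else 0)
    {x : G.Space} {v : ℝ} (hv : ∀ k : ℤ, v ≠ k) (h : r x = (v : AddCircle (1 : ℝ))) :
    x = G.pt j v := by
  have hv0 : ¬ (0 : AddCircle (1 : ℝ)) = (v : AddCircle (1 : ℝ)) := fun h0 => by
    rw [← AddCircle.coe_zero, eq_comm, coe_addCircle_eq_iff] at h0
    obtain ⟨k, hk⟩ := h0
    exact hv k (by rw [hk, zero_add])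
  rcases G.eq_base_or_exists_pt x with rfl | ⟨i, t, -, rfl⟩
  · rw [← G.pt_zero j, hr, if_pos rfl] at h
    exact absurd h hv0
  · rw [hr] at h
    split_ifs at h with hij
    · subst hij
      obtain ⟨k, rfl⟩ := coe_addCircle_eq_iff.1 h
      exact G.pt_add_int i v k
    · exact absurd h hv0

theorem pt_ne_base_iff {i : Fin n} {t : ℝ} : G.pt i t ≠ G.base ↔ ∀ k : ℤ, t ≠ k := by
  rw [Ne, pt_eq_base_iff, not_exists]

theorem ne_int_of_mem_Ioo {t : ℝ} (ht : t ∈ Set.Ioo (0 : ℝ) 1) (k : ℤ) : t ≠ k :=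
  ne_intCast_of_floor_lt (m := 0) (by simpa using ht.1) (by simpa using ht.2) k

theorem eventually_ne_int {v : ℝ → ℝ} {t : ℝ} (hv : ContinuousAt v t) (h : ∀ k : ℤ, v t ≠ k) :
    ∀ᶠ u in 𝓝 t, ∀ k : ℤ, v u ≠ k := by
  have h1 : (⌊v t⌋ : ℝ) < v t := (Int.floor_le _).lt_of_ne (h _).symm
  filter_upwards [hv.eventually (lt_mem_nhds h1),
    hv.eventually (gt_mem_nhds (Int.lt_floor_add_one _))]
    with u hu1 hu2
  exact ne_intCast_of_floor_lt hu1 hu2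

/-- Near a point whose image is not `b`, a continuous map lifts to the parameter line. -/
theorem exists_local_lift [Nonempty (Fin n)] {g : G.Space → G.Space} (hg : Continuous g)
    {i j : Fin n} {t s : ℝ} (h : g (G.pt i t) = G.pt j s) (hs : ∀ k : ℤ, s ≠ k) :
    ∃ v : ℝ → ℝ, Continuous v ∧ v t = s ∧ ∀ᶠ u in 𝓝 t, g (G.pt i u) = G.pt j (v u) := by
  obtain ⟨r, hr⟩ := G.exists_retraction j
  obtain ⟨L, hL⟩ := SingularOne.exists_lift_addCircle
    (r.comp ((⟨g, hg⟩ : C(G.Space, G.Space)).comp (G.loop i)))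
  have hL : ∀ u, (L u : AddCircle (1 : ℝ)) = r (g (G.pt i u)) := hL
  have ht := hL t
  rw [h, hr, if_pos rfl, coe_addCircle_eq_iff] at ht
  obtain ⟨k, hk⟩ := ht
  have hv : Continuous fun u => L u - k := by fun_prop
  refine ⟨fun u => L u - k, hv, by simp [hk], ?_⟩
  have hs' : ∀ m : ℤ, (fun u => L u - k) t ≠ m := by simpa [hk] using hs
  filter_upwards [eventually_ne_int hv.continuousAt hs'] with u hu
  refine G.eq_pt_of_retraction hr hu ?_
  rw [← hL, coe_addCircle_eq_iff]
  exact ⟨k, by ring⟩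

/-- The set of parameters of fixed points on a circle. -/
def fixedParams (g : G.Space → G.Space) (i : Fin n) : Set ℝ :=
  {t ∈ Set.Ioo (0 : ℝ) 1 | g (G.pt i t) = G.pt i t}

/-- As `b` is not fixed, each fixed point has exactly one circle and one parameter in `(0,1)`. -/
theorem fixedPoints_finite_and_ncard {g : G.Space → G.Space} (hb : g G.base ≠ G.base)
    (h : ∀ i, (G.fixedParams g i).Finite) :
    (Function.fixedPoints g).Finite ∧
      (Function.fixedPoints g).ncard = ∑ i, (G.fixedParams g i).ncard := by
  classical
  let F : Finset (Σ _ : Fin n, ℝ) := Finset.univ.sigma fun i => (h i).toFinset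
  have hinj : Set.InjOn (fun z : Σ _ : Fin n, ℝ => G.pt z.1 z.2) F := by
    rintro ⟨i, s⟩ hz ⟨j, t⟩ hw hzw
    have hs : s ∈ G.fixedParams g i := by simpa [F] using hz
    have ht : t ∈ G.fixedParams g j := by simpa [F] using hw
    rcases G.arc_eq_arc (G.pt_eq_pt_iff_arc.1 hzw) with ⟨hij, k, hk⟩ | ⟨⟨k, hk⟩, -⟩
    · simp only at hij hk
      subst hij
      have h1 : k < 1 := by exact_mod_cast (by linarith [hs.1.2, ht.1.1] : (k : ℝ) < 1)
      have h2 : -1 < k := by exact_mod_cast (by linarith [hs.1.1, ht.1.2] : (-1 : ℝ) < k)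
      obtain rfl : k = 0 := by omega
      simp at hk
      rw [hk]
    · exact absurd hk (ne_int_of_mem_Ioo hs.1 k)
  have heq : Function.fixedPoints g = (F.image fun z => G.pt z.1 z.2 : Finset G.Space) := by
    ext x
    constructor
    · intro hx
      rcases G.eq_base_or_exists_pt x with rfl | ⟨i, t, ht, rfl⟩
      · exact absurd hx hb
      · exact Finset.mem_coe.2 (Finset.mem_image.2 ⟨⟨i, t⟩, by simpa [F] using ⟨ht, hx⟩, rfl⟩)
    · intro hx
      obtain ⟨⟨i, t⟩, hz, rfl⟩ := Finset.mem_image.1 (Finset.mem_coe.1 hx)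
      have ht : t ∈ G.fixedParams g i := by simpa [F] using hz
      exact ht.2
  rw [heq]
  refine ⟨Finset.finite_toSet _, ?_⟩
  rw [Set.ncard_coe_finset, Finset.card_image_of_injOn hinj, Finset.card_sigma]
  exact Finset.sum_congr rfl fun i _ => (Set.ncard_eq_toFinset_card _ (h i)).symm

/-- The Lefschetz number of a self-map of a bouquet all of whose fixed points have index `-ε`,
the branching point not being fixed. -/
theorem lefschetzNumber_eq_ncard [Nonempty (Fin n)] (g : C(G.Space, G.Space))
    (hb : g G.base ≠ G.base) {ε : ℤ} (hε : ε = 1 ∨ ε = -1)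
    (h : ∀ i, ∀ t ∈ G.fixedParams g i, ∃ d : ℝ,
      HasDerivAt (fun u => (g (G.pt i u) : ℂ)) (d • deriv (G.arc i) t) t ∧ 0 < ε * (d - 1)) :
    (Function.fixedPoints g).Finite ∧
      lefschetzNumber 1 g = -ε * ((Function.fixedPoints g).ncard : ℚ) := by
  choose r hr using G.exists_retraction
  choose θ hθ using fun i => SingularOne.exists_lift_addCircle ((r i).comp (g.comp (G.loop i)))
  have hθ : ∀ i t, (θ i t : AddCircle (1 : ℝ)) = r i (g (G.pt i t)) := hθ
  have hpt1 : ∀ i, G.pt i 1 = G.base := fun i => by simpa using G.pt_int i 1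
  choose D hD using fun i => coe_addCircle_eq_iff.1
    (show (θ i 1 : AddCircle (1 : ℝ)) = θ i 0 by rw [hθ, hθ, hpt1, pt_zero])
  -- `S_j` is the only circle through `g b`; the count on it differs from the others by the
  -- correction `ε`.
  obtain ⟨j, c, hc, hgb⟩ := (G.eq_base_or_exists_pt (g G.base)).resolve_left hb
  have hset : ∀ i, G.fixedParams g i = {t ∈ Set.Ioo (0 : ℝ) 1 | ∃ k : ℤ, θ i t - t = k} := by
    intro i
    ext t
    refine and_congr_right fun ht => ?_
    have h1 : (∃ k : ℤ, θ i t - t = k) ↔ (θ i t : AddCircle (1 : ℝ)) = t := by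
      rw [coe_addCircle_eq_iff]
      exact exists_congr fun k => ⟨fun h => by linarith, fun h => by linarith⟩
    rw [h1, hθ]
    refine ⟨fun h => by rw [h, hr, if_pos rfl], fun h => ?_⟩
    exact G.eq_pt_of_retraction (hr i) (ne_int_of_mem_Ioo ht) h
  have hder : ∀ i, ∀ t ∈ Set.Ioo (0 : ℝ) 1, ∀ k : ℤ, θ i t - t = k →
      ∃ d, HasDerivAt (θ i) d t ∧ 0 < ε * (d - 1) := by
    intro i t ht k hk
    have hmem : t ∈ G.fixedParams g i := by
      rw [hset]
      exact ⟨ht, k, hk⟩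
    obtain ⟨d, h1, h2⟩ := h i t hmem
    refine ⟨d, ?_, h2⟩
    have hθt : θ i t = t + k := by linarith
    -- Away from integer values of `θ i`, the image is the point of `S_i` with parameter `θ i`, so
    -- `θ i` inherits the derivative of `g`.
    have hnon : ∀ m : ℤ, θ i t ≠ m := ne_intCast_of_add_int (ne_int_of_mem_Ioo ht) hθt
    refine G.hasDerivAt_of_arc_comp (θ i).continuous.continuousAt ?_ ?_ (j := i)
      (w := fun u => (g (G.pt i u) : ℂ))
    · rwa [hθt, deriv_arc_add_int]
    · filter_upwards [eventually_ne_int (θ i).continuous.continuousAt hnon] with u hu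
      exact congrArg Subtype.val (G.eq_pt_of_retraction (hr i) hu (hθ i u).symm)
  have hcount : ∀ i, (G.fixedParams g i).Finite ∧
      ((G.fixedParams g i).ncard : ℤ) = ε * D i - if i = j then ε else 0 := by
    intro i
    rw [hset]
    have h0 : (θ i 0 : AddCircle (1 : ℝ)) = if j = i then (c : AddCircle (1 : ℝ)) else 0 := by
      rw [hθ, pt_zero, hgb, hr]
    by_cases hij : i = j
    · rw [if_pos hij]
      rw [if_pos hij.symm, coe_addCircle_eq_iff] at h0
      obtain ⟨k, hk⟩ := h0
      have := finite_and_ncard_of_start_mem (θ i).continuous (hD i) hε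
        (ne_intCast_of_add_int (ne_int_of_mem_Ioo hc) hk) (hder i)
      exact ⟨this.1, this.2.trans (by ring)⟩
    · rw [if_neg hij, sub_zero]
      -- Near `b` the images stay on `S_j`, which `r i` collapses; the continuous lift can change
      -- only by integers there, so it is locally constant.
      have hconst : ∀ t₀ : ℝ, G.pt i t₀ = G.base → ∀ᶠ t in 𝓝 t₀, θ i t = θ i t₀ := by
        intro t₀ ht₀
        obtain ⟨v, -, -, hv⟩ := G.exists_local_lift g.continuous (i := i) (t := t₀)
          (by rw [ht₀, hgb]) (ne_int_of_mem_Ioo hc)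
        have hcont := (θ i).continuous.continuousAt (x := t₀)
        filter_upwards [hv, hcont.eventually (lt_mem_nhds (sub_one_lt _)),
          hcont.eventually (gt_mem_nhds (lt_add_one _))] with u hu h1 h2
        obtain ⟨k, hk⟩ := coe_addCircle_eq_iff.1 (show (θ i u : AddCircle (1 : ℝ)) = θ i t₀ by
          rw [hθ, hθ, hu, hv.self_of_nhds, hr, hr, if_neg (Ne.symm hij), if_neg (Ne.symm hij)])
        have h3 : k < 1 := by exact_mod_cast (by linarith : (k : ℝ) < 1)
        have h4 : -1 < k := by exact_mod_cast (by linarith : (-1 : ℝ) < k)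
        obtain rfl : k = 0 := by omega
        simpa using hk
      rw [if_neg (Ne.symm hij), ← AddCircle.coe_zero, coe_addCircle_eq_iff] at h0
      obtain ⟨N, hN⟩ := h0
      rw [zero_add] at hN
      refine finite_and_ncard_of_start_trivial (θ i).continuous hε (N := N) ?_ ?_ (hder i)
      · simpa only [hN] using hconst 0 (G.pt_zero i)
      · simpa only [hD, hN] using hconst 1 (hpt1 i)
  obtain ⟨hfin, hcard⟩ := G.fixedPoints_finite_and_ncard hb fun i => (hcount i).1
  refine ⟨hfin, ?_⟩
  have hL := G.lefschetzNumber_eq g r (fun j i t => hr j i t) θ hθ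
  have hsum : ((Function.fixedPoints g).ncard : ℤ) = ε * (∑ i, D i - 1) := by
    rw [hcard]
    push_cast
    rw [Finset.sum_congr rfl fun i _ => (hcount i).2, Finset.sum_sub_distrib, ← Finset.mul_sum,
      Finset.sum_ite_eq' Finset.univ j, if_pos (Finset.mem_univ j)]
    ring
  have hsum' : ((Function.fixedPoints g).ncard : ℚ) = ε * (∑ i, (D i : ℚ) - 1) := by
    exact_mod_cast hsum
  have hL' : lefschetzNumber 1 g = 1 - ∑ i, (D i : ℚ) := by
    have : ((lefschetzNumber 1 g : ℚ) : ℝ) = ((1 - ∑ i, (D i : ℚ) : ℚ) : ℝ) := by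
      rw [hL]
      push_cast
      refine congrArg _ (Finset.sum_congr rfl fun i _ => ?_)
      rw [hD i, add_sub_cancel_left]
    exact_mod_cast this
  rw [hsum', hL']
  rcases hε with rfl | rfl <;> push_cast <;> ring

end Bouquet

end

/-! ### Signs of derivatives of iterates -/

section

open Topology Filter

namespace Bouquet

variable {n : ℕ} {G : Bouquet n}

/-- At `b` this is the agreement of orientations of the tangent circles; it makes the sign of a lift
derivative independent of the circle chosen through the image. -/
theorem exists_pos_deriv_eq_smul {i j : Fin n} {s t : ℝ} (h : G.pt i s = G.pt j t) :
    ∃ c : ℝ, 0 < c ∧ deriv (G.arc i) s = c • deriv (G.arc j) t := by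
  rcases G.arc_eq_arc (G.pt_eq_pt_iff_arc.1 h) with ⟨rfl, k, rfl⟩ | ⟨⟨k, rfl⟩, l, rfl⟩
  · exact ⟨1, one_pos, by rw [one_smul, deriv_arc_add_int]⟩
  · obtain ⟨c, hc, h⟩ := G.tangent_at_b i j
    refine ⟨c, hc, ?_⟩
    rw [← zero_add (k : ℝ), ← zero_add (l : ℝ), deriv_arc_add_int, deriv_arc_add_int, h]

theorem HasLiftDeriv.sign_eq {g : G.Space → G.Space} {i : Fin n} {t d d' : ℝ}
    (h : G.HasLiftDeriv g i t d) (h' : G.HasLiftDeriv g i t d') :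
    SignType.sign d = SignType.sign d' := by
  obtain ⟨j, s, h1, h2⟩ := h
  obtain ⟨j', s', h1', h2'⟩ := h'
  obtain ⟨c, hc, hcd⟩ := exists_pos_deriv_eq_smul (h1.symm.trans h1')
  have h3 := h2.unique h2'
  rw [hcd, smul_smul] at h3
  rw [← smul_left_injective ℝ (G.deriv_arc_ne_zero j' s') h3, sign_mul, sign_pos hc, mul_one]

/-- Chain rule: as the intermediate point is not `b`, `g` lifts locally to a real function with
derivative `d`, and `h` has to be differentiated along one arc only. -/
theorem hasDerivAt_comp [Nonempty (Fin n)] {g h : G.Space → G.Space} (hg : Continuous g)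
    {i j : Fin n} {t s d : ℝ} {z : ℂ} (hgt : g (G.pt i t) = G.pt j s) (hs : ∀ k : ℤ, s ≠ k)
    (hgd : HasDerivAt (fun u => (g (G.pt i u) : ℂ)) (d • deriv (G.arc j) s) t)
    (hh : HasDerivAt (fun u => (h (G.pt j u) : ℂ)) z s) :
    HasDerivAt (fun u => (h (g (G.pt i u)) : ℂ)) (d • z) t := by
  obtain ⟨v, hv, rfl, hvg⟩ := G.exists_local_lift hg hgt hs
  have hvd : HasDerivAt v d t := G.hasDerivAt_of_arc_comp hv.continuousAt hgd
    (hvg.mono fun u hu => congrArg Subtype.val hu)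
  refine (hh.scomp t hvd).congr_of_eventuallyEq (hvg.mono fun u hu => ?_)
  simp only [Function.comp_apply, hu]

/-- The sign of the derivative of an iterate along an orbit that avoids the branching point. -/
theorem exists_hasLiftDeriv_iterate [Nonempty (Fin n)] {f : G.Space → G.Space}
    (hf : Continuous f) {σ : SignType}
    (hσ : ∀ i, ∀ t ∈ Set.Ioo (0 : ℝ) 1, ∃ d, G.HasLiftDeriv f i t d ∧ SignType.sign d = σ)
    (i : Fin n) (t : ℝ) (m : ℕ) (horb : ∀ k ≤ m, f^[k] (G.pt i t) ≠ G.base) :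
    ∃ d, G.HasLiftDeriv f^[m] i t d ∧ SignType.sign d = σ ^ m := by
  induction m with
  | zero =>
    refine ⟨1, ⟨i, t, rfl, ?_⟩, by simp⟩
    rw [one_smul]
    exact G.hasDerivAt_arc i t
  | succ m ih =>
    obtain ⟨d, ⟨j, s, h1, h2⟩, hd⟩ := ih fun k hk => horb k (hk.trans m.le_succ)
    have hs : ∀ k : ℤ, s ≠ k := G.pt_ne_base_iff.1 (h1 ▸ horb m m.le_succ)
    -- The sign hypothesis concerns parameters in `(0,1)`, so `s` is replaced by its fractional
    -- part.
    have hs' : Int.fract s ∈ Set.Ioo (0 : ℝ) 1 :=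
      ⟨Int.fract_pos.2 (hs _), Int.fract_lt_one s⟩
    have hsf : s = Int.fract s + (⌊s⌋ : ℤ) := (Int.fract_add_floor s).symm
    obtain ⟨e, ⟨j', s', h3, h4⟩, he⟩ := hσ j _ hs'
    have h1' : f^[m] (G.pt i t) = G.pt j (Int.fract s) := by
      rw [h1]
      conv_lhs => rw [hsf]
      exact G.pt_add_int j _ _
    have hder : deriv (G.arc j) s = deriv (G.arc j) (Int.fract s) := by
      conv_lhs => rw [hsf]
      exact G.deriv_arc_add_int j _ _
    rw [hder] at h2
    have h5 := hasDerivAt_comp (hf.iterate m) h1' (ne_int_of_mem_Ioo hs') h2 h4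
    refine ⟨d * e, ⟨j', s', ?_, ?_⟩, ?_⟩
    · rw [Function.iterate_succ_apply', h1', h3]
    · rw [← smul_smul]
      simpa only [Function.iterate_succ_apply'] using h5
    · rw [sign_mul, hd, he, pow_succ]

/-- Every point on the orbit of a fixed point of `f^m` is fixed by `f^m`, and `b` is not. -/
theorem iterate_ne_base_of_mem_fixedParams {f : G.Space → G.Space} {m : ℕ}
    (hb : f^[m] G.base ≠ G.base) {i : Fin n} {t : ℝ} (ht : t ∈ G.fixedParams f^[m] i) (k : ℕ) :
    f^[k] (G.pt i t) ≠ G.base := fun h => hb <| by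
  rw [← h, ← Function.iterate_add_apply, add_comm, Function.iterate_add_apply, ht.2]

/-- Near a fixed point of an iterate the orientation behaviour is governed by the sign of the
derivative. -/
theorem frequently_sign_eq [Nonempty (Fin n)] {f : G.Space → G.Space}
    (hf : Continuous f) {σ : SignType}
    (hσ : ∀ i, ∀ t ∈ Set.Ioo (0 : ℝ) 1, ∃ d, G.HasLiftDeriv f i t d ∧ SignType.sign d = σ)
    {m : ℕ} (hb : f^[m] G.base ≠ G.base) {i : Fin n} {t₀ : ℝ} (ht₀ : t₀ ∈ G.fixedParams f^[m] i)
    {p : ℝ → Prop} (hp : {t ∈ Set.Ioo (0 : ℝ) 1 | ¬ ∃ d, p d ∧ G.HasLiftDeriv f^[m] i t d}.Finite) :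
    ∃ d, p d ∧ SignType.sign d = σ ^ m := by
  -- The parameter `t₀` may itself be exceptional. Nearby orbits also avoid `b` up to time `m`, and
  -- the finite exceptional set misses a punctured neighbourhood, so a nearby parameter serves.
  have horb : ∀ᶠ t in 𝓝 t₀, ∀ k ∈ Finset.range (m + 1), f^[k] (G.pt i t) ≠ G.base := by
    rw [Filter.eventually_all_finset]
    intro k _
    exact ((hf.iterate k).comp (G.loop i).continuous).continuousAt.eventually_ne
      (iterate_ne_base_of_mem_fixedParams hb ht₀ k)
  have hinf : ∃ᶠ t in 𝓝[≠] t₀, True := by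
    rw [Filter.frequently_true_iff_neBot]
    infer_instance
  have hfin : ∀ᶠ t in 𝓝[≠] t₀,
      t ∉ {t ∈ Set.Ioo (0 : ℝ) 1 | ¬ ∃ d, p d ∧ G.HasLiftDeriv f^[m] i t d} := by
    set B := {t ∈ Set.Ioo (0 : ℝ) 1 | ¬ ∃ d, p d ∧ G.HasLiftDeriv f^[m] i t d}
    have h0 : t₀ ∉ B \ {t₀} := fun h => h.2 rfl
    have h := (hp.subset Set.sdiff_subset : (B \ {t₀}).Finite).isClosed.isOpen_compl.mem_nhds h0
    filter_upwards [mem_nhdsWithin_of_mem_nhds h, self_mem_nhdsWithin] with t h1 h2 h3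
    exact h1 ⟨h3, h2⟩
  obtain ⟨t, -, ht1, ht2, ht3⟩ := (hinf.and_eventually (hfin.and
    ((horb.filter_mono nhdsWithin_le_nhds).and
      (mem_nhdsWithin_of_mem_nhds (Ioo_mem_nhds ht₀.1.1 ht₀.1.2))))).exists
  have h1 : ∃ d, p d ∧ G.HasLiftDeriv f^[m] i t d := by
    by_contra h
    exact ht1 ⟨ht3, h⟩
  obtain ⟨d, hd, hd'⟩ := h1
  obtain ⟨e, he, he'⟩ := exists_hasLiftDeriv_iterate hf hσ i t m
    fun k hk => ht2 k (Finset.mem_range.2 (by omega))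
  exact ⟨d, hd, (hd'.sign_eq he).trans he'⟩

theorem MemMb.nonempty {f : C(G.Space, G.Space)} (hf : G.MemMb f) : Nonempty (Fin n) := by
  obtain ⟨i, -⟩ := (G.eq_base_or_exists_pt (f G.base)).resolve_left (hf.b_not_periodic 1 le_rfl)
  exact ⟨i⟩

/-- A repelling fixed point has `d > 1` or `d < -1`, so `ε (d - 1) > 0` for `ε` the sign of `d`. The
sign is needed at fixed points only. -/
theorem MemMb.lefschetzNumber_iter {f : C(G.Space, G.Space)} (hf : G.MemMb f) {σ : SignType}
    (hσ : ∀ i, ∀ t ∈ Set.Ioo (0 : ℝ) 1, ∃ d, G.HasLiftDeriv f i t d ∧ SignType.sign d = σ)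
    {m : ℕ} (hm : 1 ≤ m) {ε : ℤ} (hε : ε = 1 ∨ ε = -1)
    (h : ∀ i, ∀ t ∈ G.fixedParams f^[m] i, ((σ ^ m : SignType) : ℤ) = ε) :
    (Function.fixedPoints f^[m]).Finite ∧
      lefschetzNumber 1 (iter f m) = -ε * ((Function.fixedPoints f^[m]).ncard : ℚ) := by
  have := hf.nonempty
  have hb := hf.b_not_periodic m hm
  refine G.lefschetzNumber_eq_ncard (iter f m) hb hε fun i t ht => ?_
  obtain ⟨d, hd, hd1⟩ := hf.repelling m hm i t ht.1 ht.2
  refine ⟨d, hd, ?_⟩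
  obtain ⟨e, he, he'⟩ := exists_hasLiftDeriv_iterate f.continuous hσ i t m
    fun k _ => iterate_ne_base_of_mem_fixedParams hb ht k
  have hde : SignType.sign d = σ ^ m :=
    (HasLiftDeriv.sign_eq (⟨i, t, ht.2, hd⟩ : G.HasLiftDeriv f^[m] i t d) he).trans he'
  have hεd : ((SignType.sign d : SignType) : ℤ) = ε := by rw [hde, h i t ht]
  rcases hε with rfl | rfl
  · have : SignType.sign d = 1 := by
      revert hεd
      cases SignType.sign d <;> simp
    have hd0 := sign_eq_one_iff.1 this
    rw [abs_of_pos hd0] at hd1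
    push_cast
    linarith
  · have : SignType.sign d = -1 := by
      revert hεd
      cases SignType.sign d <;> simp
    have hd0 := sign_eq_neg_one_iff.1 this
    rw [abs_of_neg hd0] at hd1
    push_cast
    linarith

theorem sign_eq_of_forall_finite [Nonempty (Fin n)] {f : G.Space → G.Space} {σ : SignType}
    (hσ : ∀ i, ∀ t ∈ Set.Ioo (0 : ℝ) 1, ∃ d, G.HasLiftDeriv f i t d ∧ SignType.sign d = σ)
    {p : ℝ → Prop}
    (hp : ∀ i, {t ∈ Set.Ioo (0 : ℝ) 1 | ¬ ∃ d, p d ∧ G.HasLiftDeriv f i t d}.Finite) :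
    ∃ d, p d ∧ SignType.sign d = σ := by
  obtain ⟨i⟩ := ‹Nonempty (Fin n)›
  obtain ⟨t, ht, hnt⟩ := ((Set.Ioo_infinite (zero_lt_one' ℝ)).sdiff (hp i)).nonempty
  have h1 : ∃ d, p d ∧ G.HasLiftDeriv f i t d := by
    by_contra h
    exact hnt ⟨ht, h⟩
  obtain ⟨d, hd, hd'⟩ := h1
  obtain ⟨e, he, he'⟩ := hσ i t ht
  exact ⟨d, hd, (hd'.sign_eq he).trans he'⟩

end Bouquet

/-! ### Möbius inversion for periodic points, and the theorem -/

theorem periodicPoints_subset_fixedPoints {X : Type} (f : X → X) (m : ℕ) :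
    periodicPoints f m ⊆ Function.fixedPoints f^[m] := fun _ hx =>
  Function.isPeriodicPt_iff_minimalPeriod_dvd.2 hx.2.dvd

theorem ncard_fixedPoints_iterate {X : Type} (f : X → X) {m : ℕ} (hm : 0 < m)
    (hfin : ∀ k, 0 < k → (Function.fixedPoints f^[k]).Finite) :
    (Function.fixedPoints f^[m]).ncard = ∑ k ∈ m.divisors, (periodicPoints f k).ncard := by
  classical
  rw [Set.ncard_eq_toFinset_card _ (hfin m hm), Finset.card_eq_sum_card_fiberwise
    (f := Function.minimalPeriod f) (t := m.divisors) fun x hx => by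
      have hx : x ∈ Function.fixedPoints f^[m] := by simpa using hx
      exact Finset.mem_coe.2 (Nat.mem_divisors.2
        ⟨Function.isPeriodicPt_iff_minimalPeriod_dvd.1 hx, hm.ne'⟩)]
  refine Finset.sum_congr rfl fun k hk => ?_
  rw [← Set.ncard_coe_finset]
  congr 1
  ext x
  simp only [Finset.coe_filter, Set.Finite.mem_toFinset, Set.mem_ofPred_eq]
  constructor
  · rintro ⟨h1, h2⟩
    exact ⟨Function.mk_mem_periodicPts hm h1, h2⟩
  · rintro ⟨-, h2⟩
    exact ⟨Function.isPeriodicPt_iff_minimalPeriod_dvd.2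
      (h2 ▸ Nat.dvd_of_mem_divisors hk), h2⟩

theorem sum_moebius_mul_ncard_fixedPoints {X : Type} (f : X → X) {m : ℕ} (hm : 0 < m)
    (hfin : ∀ k, 0 < k → (Function.fixedPoints f^[k]).Finite) :
    ∑ r ∈ m.divisors, (ArithmeticFunction.moebius r : ℚ) *
      ((Function.fixedPoints f^[m / r]).ncard : ℚ) = ((periodicPoints f m).ncard : ℚ) := by
  have h := (ArithmeticFunction.sum_eq_iff_sum_mul_moebius_eq (R := ℚ)
    (f := fun k => ((periodicPoints f k).ncard : ℚ))
    (g := fun k => ((Function.fixedPoints f^[k]).ncard : ℚ))).1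
    (fun k hk => by rw [ncard_fixedPoints_iterate f hk hfin]; push_cast; rfl) m hm
  rw [← h, Nat.sum_divisorsAntidiagonal fun a b =>
    (ArithmeticFunction.moebius a : ℚ) * ((Function.fixedPoints f^[b]).ncard : ℚ)]

/-- Terms with `μ(r) = 0` drop out, so a common sign `c` is needed for squarefree `r` only; this is
what admits `4 ∣ m`. -/
theorem abs_periodicLefschetzNumber {X : Type} [TopologicalSpace X] (f : C(X, X)) {m : ℕ}
    (hm : 0 < m) (hfin : ∀ k, 0 < k → (Function.fixedPoints f^[k]).Finite) {c : ℚ} (hc : |c| = 1)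
    (h : ∀ r ∈ m.divisors, ArithmeticFunction.moebius r ≠ 0 →
      lefschetzNumber 1 (iter f (m / r)) = c * ((Function.fixedPoints f^[m / r]).ncard : ℚ)) :
    (periodicPoints f m).Finite ∧
      |periodicLefschetzNumber 1 f m| = ((periodicPoints f m).ncard : ℚ) := by
  refine ⟨(hfin m hm).subset (periodicPoints_subset_fixedPoints f m), ?_⟩
  have : periodicLefschetzNumber 1 f m = c * ((periodicPoints f m).ncard : ℚ) := by
    rw [← sum_moebius_mul_ncard_fixedPoints f hm hfin, Finset.mul_sum, periodicLefschetzNumber]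
    refine Finset.sum_congr rfl fun r hr => ?_
    by_cases h0 : ArithmeticFunction.moebius r = 0
    · simp [h0]
    · rw [h r hr h0]
      ring
  rw [this, abs_mul, hc, one_mul, abs_of_nonneg (Nat.cast_nonneg _)]

end

theorem mainTheorem1 {n : ℕ} (G : Bouquet n) (f : C(G.Space, G.Space)) (hf : G.MemMb f) :
    (∀ m : ℕ, 1 ≤ m → G.OrientationPreserving f^[m] →
      (Function.fixedPoints f^[m]).Finite ∧
        lefschetzNumber 1 (iter f m) = -((Function.fixedPoints f^[m]).ncard : ℚ)) ∧
    (∀ m : ℕ, 1 ≤ m → G.OrientationReversing f^[m] →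
      (Function.fixedPoints f^[m]).Finite ∧
        lefschetzNumber 1 (iter f m) = ((Function.fixedPoints f^[m]).ncard : ℚ)) ∧
    (G.OrientationPreserving f → ∀ m : ℕ, 1 ≤ m →
      (periodicPoints f m).Finite ∧
        |periodicLefschetzNumber 1 f m| = ((periodicPoints f m).ncard : ℚ)) ∧
    (G.OrientationReversing f → ∀ m : ℕ, 1 ≤ m → Odd m ∨ 4 ∣ m →
      (periodicPoints f m).Finite ∧
        |periodicLefschetzNumber 1 f m| = ((periodicPoints f m).ncard : ℚ)) := by
  have := hf.nonempty
  obtain ⟨σ, hσ⟩ := hf.sign_const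
  refine ⟨fun m hm hop => ?_, fun m hm hor => ?_, fun hop m hm => ?_, fun hor m hm hm' => ?_⟩
  · have h := hf.lefschetzNumber_iter hσ hm (ε := 1) (Or.inl rfl) fun i t ht => by
      obtain ⟨d, hd, hds⟩ := Bouquet.frequently_sign_eq f.continuous hσ (hf.b_not_periodic m hm) ht
        (hop i)
      rw [← hds, sign_pos hd]
      rfl
    simpa using h
  · have h := hf.lefschetzNumber_iter hσ hm (ε := -1) (Or.inr rfl) fun i t ht => by
      obtain ⟨d, hd, hds⟩ := Bouquet.frequently_sign_eq f.continuous hσ (hf.b_not_periodic m hm) ht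
        (hor i)
      rw [← hds, sign_neg hd]
      rfl
    simpa using h
  · obtain ⟨d, hd, hds⟩ := Bouquet.sign_eq_of_forall_finite hσ hop
    obtain rfl : σ = 1 := by rw [← hds, sign_pos hd]
    have key := fun (k : ℕ) (hk : 1 ≤ k) => hf.lefschetzNumber_iter hσ hk (ε := 1) (Or.inl rfl)
      fun i t _ => by simp
    refine abs_periodicLefschetzNumber f hm (fun k hk => (key k hk).1) (c := -1) (by simp)
      fun r hr _ => ?_
    rw [(key (m / r) (Nat.div_pos (Nat.divisor_le hr) (Nat.pos_of_mem_divisors hr))).2]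
    simp
  · obtain ⟨d, hd, hds⟩ := Bouquet.sign_eq_of_forall_finite hσ hor
    obtain rfl : σ = -1 := by rw [← hds, sign_neg hd]
    -- With `σ = -1` the sign in `L(f^k) = ±#Fix(f^k)` alternates with the parity of `k`.
    have heven := fun (k : ℕ) (hk : 1 ≤ k) (hk' : Even k) =>
      hf.lefschetzNumber_iter hσ hk (ε := 1) (Or.inl rfl) fun i t _ => by
        rw [hk'.neg_one_pow]; rfl
    have hodd := fun (k : ℕ) (hk : 1 ≤ k) (hk' : Odd k) =>
      hf.lefschetzNumber_iter hσ hk (ε := -1) (Or.inr rfl) fun i t _ => by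
        rw [hk'.neg_one_pow]; rfl
    have hfin : ∀ k, 0 < k → (Function.fixedPoints f^[k]).Finite := fun k hk =>
      (Nat.even_or_odd k).elim (fun h => (heven k hk h).1) fun h => (hodd k hk h).1
    rcases hm' with hm' | hm'
    · refine abs_periodicLefschetzNumber f hm hfin (c := 1) (by simp) fun r hr _ => ?_
      have hmr : Odd (m / r) :=
        hm'.of_dvd_nat (Nat.div_dvd_of_dvd (Nat.dvd_of_mem_divisors hr))
      rw [(hodd (m / r) hmr.pos hmr).2]
      simp
    · refine abs_periodicLefschetzNumber f hm hfin (c := -1) (by simp) fun r hr hμ => ?_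
      have hsq := ArithmeticFunction.moebius_ne_zero_iff_squarefree.1 hμ
      have hdvd := Nat.dvd_of_mem_divisors hr
      -- If `m / r` were odd, the factor 4 of `m` would divide the squarefree number `r`.
      have hmr : Even (m / r) := by
        by_contra hodd'
        rw [Nat.not_even_iff_odd] at hodd'
        have h4 : 4 ∣ m / r * r := by rwa [Nat.div_mul_cancel hdvd]
        have hcop : Nat.Coprime 4 (m / r) :=
          (Nat.Coprime.pow_left 2 (Nat.coprime_two_left.2 hodd') : Nat.Coprime (2 ^ 2) (m / r))
        have h4r : 2 * 2 ∣ r := hcop.dvd_of_dvd_mul_left h4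
        exact absurd (hsq 2 h4r) (by decide)
      rw [(heven (m / r) (Nat.div_pos (Nat.divisor_le hr) (Nat.pos_of_mem_divisors hr)) hmr).2]
      simp
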